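/- There exist absolute constants $C_0,c_1,c_2,c_3>0$ and nonnegative numbers $C_n=C_{n,p,s}$ with $$C_{n,p,s}\le C_0\,\frac{s\vee\sqrt{s\log p}}{\sqrt n}\qquad\text{for all } n,p,s$$ (so $C_n=O((s\vee\sqrt{s\log p})/\sqrt n)$) such that the following holds. Let $n,p\ge 1$, let $\beta\in\mathbb R^p$ have support $S=\{j:\beta_j\neq0\}$ with $s=|S|$, and let $y=X\beta+\varepsilon$, where the rows of $X\in\mathbb R^{n\times p}$ are i.i.d. $N(0,\Sigma)$ with $\Sigma$ positive definite, and $\varepsilon_1,\dots,\varepsilon_n$ are i.i.d. $N(0,\sigma^2)$, $\sigma\ge0$, with $\varepsilon=(\varepsilon_1,\dots,\varepsilon_n)$ independent of $X$. Write $\|A\|_\infty=\max_i\sum_j|A_{ij}|$ for matrices, $\Sigma_{S,S}^{-1}=(\Sigma_{S,S})^{-1}$, and let $\Sigma_{S,S}^{-1/2}$ be the symmetric positive definite square root of $\Sigma_{S,S}^{-1}$. Assume that for real constants $\kappa,K_1,C_{\min},C_*,C^*$ with $C_{\min},C_*>0$, $$\|\Sigma_{S^c,S}\Sigma_{S,S}^{-1}\|_\infty\le\kappa<1,\qquad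 \|\Sigma_{S,S}^{-1/2}\|_\infty^2\le K_1,$$ $$\Lambda_{\min}(\Sigma_{S,S})\ge C_{\min},\qquad \frac1{\max_{j\le p}(\Sigma^{-1})_{j,j}}\ge C_*,\qquad \max_{j\le p}\Sigma_{j,j}\le C^*$$ (conditions on an empty block are void, and the norm of an empty matrix is $0$). Let $\lambda>0$ satisfy $$s\lambda^2\le\frac{\sigma^2C_{\min}}2,\qquad \lambda\ge\frac{8\sigma}{1-\kappa}\sqrt{\frac{C^*\log p}{n}}.$$ Then, with probability greater than $1-c_1/n-2\exp(-c_2\log p)-2\exp(-c_3n)$, the Lasso problem $$\min_{b\in\mathbb R^p}\ \frac1{2n}\|y-Xb\|_2^2+\lambda\|b\|_1$$ has a solution and every solution $\hat\beta$, with support $\hat S=\{j:\hat\beta_j\ne0\}$, satisfies $$\hat S\subseteq S\qquad\text{and}\qquad \|\hat\beta_S-\beta_S\|_\infty\le(1+C_n)K_1\lambda+4\sigma\sqrt{\frac{\log p}{C_{\min}n}}.$$ -/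

import Mathlib

open MeasureTheory ProbabilityTheory

namespace LassoGaussian

/-- The support `{j : b j ≠ 0}` of a coefficient vector. -/
noncomputable def supp {p : ℕ} (b : Fin p → ℝ) : Finset (Fin p) :=
  Finset.univ.filter fun j => b j ≠ 0

/-- The block `A_{T,U}` of a square matrix, with rows in `T` and columns in `U`. -/
def block {p : ℕ} (A : Matrix (Fin p) (Fin p) ℝ) (T U : Finset (Fin p)) : Matrix T U ℝ :=
  A.submatrix (fun i => (i : Fin p)) (fun j => (j : Fin p))

/-- The matrix norm `‖A‖_∞` induced by the sup norms, i.e. the maximal absolute row sum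
(`0` if there are no rows). -/
noncomputable def infNorm {m n : Type*} [Fintype m] [Fintype n] (A : Matrix m n ℝ) : ℝ :=
  (Matrix.linftyOpNormedAddCommGroup (m := m) (n := n) (α := ℝ)).toNorm.norm A

open scoped MatrixOrder in
/-- `A^{-1/2}`: the symmetric positive semidefinite square root of the inverse of a positive
definite matrix `A`. -/
noncomputable def invSqrt {m : Type*} [Fintype m] [DecidableEq m] (A : Matrix m m ℝ) :
    Matrix m m ℝ :=
  CFC.sqrt A⁻¹

/-- The `n × p` design matrix whose `i`-th row is the vector `x i`. -/
def design {n p : ℕ} (x : Fin n → EuclideanSpace ℝ (Fin p)) : Matrix (Fin n) (Fin p) ℝ :=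
  Matrix.of fun i j => x i j

/-- The Lasso objective `‖y - A b‖₂² / (2 n) + lam ‖b‖₁`. -/
noncomputable def lassoObjective {n p : ℕ} (A : Matrix (Fin n) (Fin p) ℝ) (y : Fin n → ℝ)
    (lam : ℝ) (b : Fin p → ℝ) : ℝ :=
  1 / (2 * (n : ℝ)) * ∑ i, (y i - A.mulVec b i) ^ 2 + lam * ∑ j, |b j|

/-- The set of Lasso estimates: all global minimizers of the Lasso objective. -/
def lassoSolutions {n p : ℕ} (A : Matrix (Fin n) (Fin p) ℝ) (y : Fin n → ℝ) (lam : ℝ) :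
    Set (Fin p → ℝ) :=
  {b | ∀ b', lassoObjective A y lam b ≤ lassoObjective A y lam b'}

/-- `‖v_T‖_∞`, the sup norm of the restriction of `v` to `T` (`0` if `T` is empty). -/
noncomputable def supNormOn {p : ℕ} (T : Finset (Fin p)) (v : Fin p → ℝ) : ℝ :=
  ‖fun j : T => v j‖

end LassoGaussian

/-! The proof is the primal-dual witness argument. Write `A` for the columns of the design in `S`,
`e` for the noise, `β` for the coefficients on `S`, and let `b` be a stationary point of the Lasso
restricted to `S`, with residual `r`. If `|x_j · r| < n λ` for every column `x_j` off `S`, and `A`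
is injective, then `b` extended by zero is the only solution of the full problem
(`lassoSolutions_of_witness`), so support inclusion is immediate and only `b - β` remains to be
bounded.

Dual feasibility. Regress a column `j` outside `S` on the columns in `S`: `x_j = A c + g`. The part
`c · Aᵀ r` is at most `κ n λ`, by incoherence and stationarity. The entries of `g` are i.i.d.
Gaussian with variance at most `Sig j j`, and `g` is independent of `A` and `e`, hence of `r`. As `r
· r ≤ e · e + (n λ)² s / N ≤ 3 n σ²` with `N = n Cmin / 2`, a Gaussian tail gives `|r · g| < (1 - κ)
n λ` for all `j` at once (`IsStationary.residual_le`, `measure_residual_le`).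

Sup norm error. Stationarity gives `b - β = (AᵀA)⁻¹ Aᵀ e - λ n (AᵀA)⁻¹ z` with `|z k| ≤ 1`. Given
`A`, each coordinate of the first term is Gaussian with variance at most `σ² / N`
(`measure_leastSquaresEvent_le`). For the second, whitening with `R = Σ_SS^{-1/2}` turns the
normalized inverse Gram matrix into `R (1 + M)⁻¹ R`. A spectral bound `δ` on `M` then costs only a
factor `1 + 2 δ √s` over `‖R‖_∞²` (`abs_le_of_gram_mulVec_eq`), and a net argument provides `δ` of
order `√((s + log p) / n)` (`exists_gramClose`).

No sample size condition is needed: the upper and lower bounds on `λ` together force `s log p ≤ n /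
128` (`card_mul_le`). If `log p` is below an absolute constant, the asserted probability is
negative. -/

namespace LassoGaussian

open Matrix
open scoped NNReal ENNReal

/-! ### Existence and uniqueness of stationary points of the Lasso -/

section Lasso

variable {ι κ : Type*} [Fintype ι] [Fintype κ]

/-- The stationarity conditions of `‖y - A b‖₂² / 2 + m ‖b‖₁`. -/
def IsStationary (A : Matrix ι κ ℝ) (y : ι → ℝ) (m : ℝ) (b : κ → ℝ) : Prop :=
  (∀ k, |(Aᵀ *ᵥ (y - A *ᵥ b)) k| ≤ m) ∧ ∀ k, (Aᵀ *ᵥ (y - A *ᵥ b)) k * b k = m * |b k|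

lemma dotProduct_self_add_sub (y u v : ι → ℝ) :
    (y - (u + v)) ⬝ᵥ (y - (u + v)) = (y - u) ⬝ᵥ (y - u) - 2 * ((y - u) ⬝ᵥ v) + v ⬝ᵥ v := by
  simp only [dotProduct, Finset.mul_sum, ← Finset.sum_sub_distrib, ← Finset.sum_add_distrib]
  refine Finset.sum_congr rfl fun i _ => ?_
  simp only [Pi.sub_apply, Pi.add_apply]
  ring

lemma exists_minimizer (A : Matrix ι κ ℝ) (y : ι → ℝ) {m : ℝ} (hm : 0 < m) :
    ∃ b : κ → ℝ, ∀ b' : κ → ℝ,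
      (y - A *ᵥ b) ⬝ᵥ (y - A *ᵥ b) / 2 + m * ∑ k, |b k| ≤
        (y - A *ᵥ b') ⬝ᵥ (y - A *ᵥ b') / 2 + m * ∑ k, |b' k| := by
  have hc : Continuous fun b : κ → ℝ =>
      (y - A *ᵥ b) ⬝ᵥ (y - A *ᵥ b) / 2 + m * ∑ k, |b k| := by
    have : Continuous fun b : κ → ℝ => y - A *ᵥ b :=
      continuous_const.sub (continuous_const.matrix_mulVec continuous_id)
    have h2 := this.dotProduct this
    fun_prop
  refine hc.exists_forall_le (Filter.tendsto_atTop_mono (f := fun b : κ → ℝ => m * ‖b‖)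
    (fun b => ?_) ?_)
  · have h0 : (0:ℝ) ≤ (y - A *ᵥ b) ⬝ᵥ (y - A *ᵥ b) :=
      Finset.sum_nonneg fun i _ => mul_self_nonneg _
    have h1 : ‖b‖ ≤ ∑ k, |b k| := by
      refine (pi_norm_le_iff_of_nonneg (Finset.sum_nonneg fun k _ => abs_nonneg _)).2 fun k => ?_
      exact Finset.single_le_sum (f := fun k => |b k|) (fun k _ => abs_nonneg _) (Finset.mem_univ k)
    nlinarith [mul_le_mul_of_nonneg_left h1 hm.le]
  · exact (tendsto_norm_cocompact_atTop).const_mul_atTop hm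

/-- First-order conditions in one variable. Small increments make the quadratic term negligible: `t
= ±τ` bounds the slope, and `t = -τ x`, which shrinks `x` towards zero, gives complementary
slackness. -/
lemma abs_le_and_mul_eq_of_forall {g q m x : ℝ} (hm : 0 ≤ m)
    (h : ∀ t, g * t ≤ q * t ^ 2 + m * (|x + t| - |x|)) : |g| ≤ m ∧ g * x = m * |x| := by
  have key : ∀ a c : ℝ, (∀ τ : ℝ, 0 < τ → τ ≤ 1 → a ≤ c * τ) → a ≤ 0 := by
    intro a c hac
    have hl : Filter.Tendsto (fun τ : ℝ => c * τ) (nhdsWithin 0 (Set.Ioi 0)) (nhds 0) := by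
      have : Filter.Tendsto (fun τ : ℝ => c * τ) (nhds 0) (nhds (c * 0)) :=
        (continuous_const.mul continuous_id).tendsto 0
      rw [mul_zero] at this
      exact this.mono_left nhdsWithin_le_nhds
    refine ge_of_tendsto hl ?_
    filter_upwards [Ioc_mem_nhdsGT (show (0:ℝ) < 1 by norm_num)] with τ hτ
    exact hac τ hτ.1 hτ.2
  have h1 : |g| ≤ m := by
    rw [abs_le]
    constructor
    · have := key (-g - m) q fun τ h0 _ => by
        have h1 := h (-τ)
        have h2 : |x + -τ| - |x| ≤ τ := by
          have := abs_add_le x (-τ); rw [abs_neg, abs_of_pos h0] at this; linarith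
        have h3 := mul_le_mul_of_nonneg_left h2 hm
        have : (-g - m) * τ ≤ (q * τ) * τ := by nlinarith
        exact le_of_mul_le_mul_right this h0
      linarith
    · have := key (g - m) q fun τ h0 _ => by
        have h1 := h τ
        have h2 : |x + τ| - |x| ≤ τ := by
          have := abs_add_le x τ; rw [abs_of_pos h0] at this; linarith
        have h3 := mul_le_mul_of_nonneg_left h2 hm
        have : (g - m) * τ ≤ (q * τ) * τ := by nlinarith
        exact le_of_mul_le_mul_right this h0
      linarith
  refine ⟨h1, le_antisymm ?_ ?_⟩
  · calc g * x ≤ |g * x| := le_abs_self _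
      _ = |g| * |x| := abs_mul _ _
      _ ≤ m * |x| := mul_le_mul_of_nonneg_right h1 (abs_nonneg _)
  · have := key (m * |x| - g * x) (q * x ^ 2) fun τ h0 h1' => by
      have h2 := h (-(τ * x))
      have h3 : |x + -(τ * x)| = (1 - τ) * |x| := by
        rw [show x + -(τ * x) = (1 - τ) * x by ring, abs_mul, abs_of_nonneg (by linarith)]
      rw [h3] at h2
      have : (m * |x| - g * x) * τ ≤ (q * x ^ 2 * τ) * τ := by nlinarith
      exact le_of_mul_le_mul_right this h0
    linarith

lemma exists_isStationary (A : Matrix ι κ ℝ) (y : ι → ℝ) {m : ℝ} (hm : 0 < m) :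
    ∃ b, IsStationary A y m b := by
  classical
  obtain ⟨b, hb⟩ := exists_minimizer A y hm
  have key : ∀ k, |(Aᵀ *ᵥ (y - A *ᵥ b)) k| ≤ m ∧
      (Aᵀ *ᵥ (y - A *ᵥ b)) k * b k = m * |b k| := by
    intro k
    refine abs_le_and_mul_eq_of_forall (q := ∑ i, A i k * A i k / 2) hm.le fun t => ?_
    have h1 := hb (b + Pi.single k t)
    have h2 : A *ᵥ (Pi.single k t) = fun i => A i k * t := by
      ext i; simp
    rw [mulVec_add, dotProduct_self_add_sub, h2] at h1
    have h3 : ∑ j, |(b + Pi.single k t : κ → ℝ) j| = ∑ j, |b j| + (|b k + t| - |b k|) := by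
      rw [← Finset.add_sum_erase _ _ (Finset.mem_univ k),
        ← Finset.add_sum_erase _ (fun j => |b j|) (Finset.mem_univ k)]
      have : ∑ j ∈ Finset.univ.erase k, |(b + Pi.single k t : κ → ℝ) j| =
          ∑ j ∈ Finset.univ.erase k, |b j| :=
        Finset.sum_congr rfl fun j hj => by simp [Finset.ne_of_mem_erase hj]
      rw [this]
      simp
      ring
    have h4 : ((y - A *ᵥ b) ⬝ᵥ fun i => A i k * t) = (Aᵀ *ᵥ (y - A *ᵥ b)) k * t := by
      simp only [dotProduct, mulVec, transpose_apply, Finset.sum_mul]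
      exact Finset.sum_congr rfl fun i _ => by ring
    have h5 : ((fun i => A i k * t) ⬝ᵥ fun i => A i k * t) =
        2 * ((∑ i, A i k * A i k / 2) * t ^ 2) := by
      simp only [dotProduct, Finset.mul_sum, Finset.sum_mul]
      exact Finset.sum_congr rfl fun i _ => by ring
    rw [h3, h4, h5] at h1
    linarith
  exact ⟨b, fun k => (key k).1, fun k => (key k).2⟩

lemma IsStationary.mul_le {A : Matrix ι κ ℝ} {y : ι → ℝ} {m : ℝ} {b : κ → ℝ}
    (h : IsStationary A y m b) (k : κ) (x : ℝ) :
    (Aᵀ *ᵥ (y - A *ᵥ b)) k * x ≤ m * |x| :=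
  calc _ ≤ |(Aᵀ *ᵥ (y - A *ᵥ b)) k * x| := le_abs_self _
    _ = |(Aᵀ *ᵥ (y - A *ᵥ b)) k| * |x| := abs_mul _ _
    _ ≤ m * |x| := mul_le_mul_of_nonneg_right (h.1 k) (abs_nonneg _)

lemma transpose_mulVec_dotProduct (A : Matrix ι κ ℝ) (r : ι → ℝ) (v : κ → ℝ) :
    (Aᵀ *ᵥ r) ⬝ᵥ v = r ⬝ᵥ (A *ᵥ v) := by
  rw [mulVec_transpose, dotProduct_mulVec]

/-- The subdifferential of the `ℓ¹` norm is monotone, so the difference of the two dual vectors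
pairs nonnegatively with `b - b'`. This pairing also equals minus the squared length of `A (b -
b')`. -/
lemma IsStationary.eq {A : Matrix ι κ ℝ} {y : ι → ℝ} {m : ℝ} {b b' : κ → ℝ}
    (hA : ∀ h, A *ᵥ h = 0 → h = 0)
    (h : IsStationary A y m b) (h' : IsStationary A y m b') : b = b' := by
  have h1 : 0 ≤ (Aᵀ *ᵥ (y - A *ᵥ b) - Aᵀ *ᵥ (y - A *ᵥ b')) ⬝ᵥ (b - b') := by
    refine Finset.sum_nonneg fun k _ => ?_
    simp only [Pi.sub_apply]
    nlinarith [h.mul_le k (b' k), h'.mul_le k (b k), h.2 k, h'.2 k]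
  rw [← mulVec_sub, transpose_mulVec_dotProduct,
    show y - A *ᵥ b - (y - A *ᵥ b') = -(A *ᵥ (b - b')) by rw [mulVec_sub]; abel,
    neg_dotProduct] at h1
  have h2 : A *ᵥ (b - b') = 0 := by
    have h3 : (0:ℝ) ≤ (A *ᵥ (b - b')) ⬝ᵥ (A *ᵥ (b - b')) :=
      Finset.sum_nonneg fun i _ => mul_self_nonneg _
    exact dotProduct_self_eq_zero.1 (by linarith)
  exact sub_eq_zero.1 (hA _ h2)

end Lasso

/-! ### The primal-dual witness -/

section Witness

variable {n p : ℕ}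

/-- The columns of the design with index in `S`. -/
def subDesign (x : Fin n → EuclideanSpace ℝ (Fin p)) (S : Finset (Fin p)) :
    Matrix (Fin n) S ℝ :=
  Matrix.of fun i k => x i k

/-- Extension by zero of a vector indexed by `S`. -/
def extend (S : Finset (Fin p)) (h : S → ℝ) : Fin p → ℝ :=
  fun j => if hj : j ∈ S then h ⟨j, hj⟩ else 0

lemma extend_apply_mem {S : Finset (Fin p)} (h : S → ℝ) (k : S) : extend S h k = h k := by
  simp [extend]

lemma sum_eq_sum_subtype {S : Finset (Fin p)} (f : Fin p → ℝ) (hf : ∀ j, j ∉ S → f j = 0) :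
    ∑ j, f j = ∑ k : S, f k := by
  rw [Finset.sum_coe_sort S f]
  exact (Finset.sum_subset (Finset.subset_univ S) fun j _ hj => hf j hj).symm

lemma design_mulVec_of_support {S : Finset (Fin p)} (x : Fin n → EuclideanSpace ℝ (Fin p))
    {b : Fin p → ℝ} (hb : ∀ j, j ∉ S → b j = 0) :
    design x *ᵥ b = subDesign x S *ᵥ fun k : S => b k := by
  ext i
  simp only [mulVec, dotProduct, design, subDesign, of_apply]
  exact sum_eq_sum_subtype (fun j => x i j * b j) fun j hj => by simp [hb j hj]

/-- A stationary point of the Lasso restricted to `S` that is strictly dual feasible off `S`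
extends to the unique solution of the full Lasso. -/
theorem lassoSolutions_of_witness (hn : 1 ≤ n) {S : Finset (Fin p)}
    (x : Fin n → EuclideanSpace ℝ (Fin p)) (y : Fin n → ℝ) {lam : ℝ} {b : S → ℝ}
    (hinj : ∀ h, subDesign x S *ᵥ h = 0 → h = 0)
    (hb : IsStationary (subDesign x S) y (n * lam) b)
    (hoff : ∀ j, j ∉ S → |∑ i, x i j * (y - subDesign x S *ᵥ b) i| < n * lam) :
    lassoSolutions (design x) y lam = {extend S b} := by
  have hn' : (0:ℝ) < n := by exact_mod_cast hn
  set r := y - subDesign x S *ᵥ b with hr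
  set b₀ := extend S b with hb₀
  have hD : design x *ᵥ b₀ = subDesign x S *ᵥ b := by
    rw [design_mulVec_of_support (S := S) x (fun j hj => by simp [hb₀, extend, hj])]
    congr 1; ext k; exact extend_apply_mem b k
  set g := (design x)ᵀ *ᵥ r with hg
  have hgj : ∀ j, g j = ∑ i, x i j * r i := fun j => by
    simp [hg, mulVec, dotProduct, design]
  have hgS : ∀ k : S, g k = ((subDesign x S)ᵀ *ᵥ r) k := fun k => by
    rw [hgj]; simp [mulVec, dotProduct, subDesign]
  have hgb : ∀ j, g j * b₀ j = n * lam * |b₀ j| := fun j => by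
    by_cases hj : j ∈ S
    · have := hb.2 ⟨j, hj⟩
      rw [← hr, ← hgS] at this
      simpa [hb₀, extend, hj] using this
    · simp [hb₀, extend, hj]
  have hgl : ∀ j, |g j| ≤ n * lam := fun j => by
    by_cases hj : j ∈ S
    · have := hb.1 ⟨j, hj⟩
      rwa [← hr, ← hgS] at this
    · rw [hgj]; exact (hoff j hj).le
  have hterm : ∀ (b' : Fin p → ℝ) j, 0 ≤ n * lam * |b' j| - g j * b' j := fun b' j => by
    have h1 : g j * b' j ≤ |g j| * |b' j| := by rw [← abs_mul]; exact le_abs_self _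
    have h2 := mul_le_mul_of_nonneg_right (hgl j) (abs_nonneg (b' j))
    linarith
  -- The excess objective is exactly a squared prediction distance plus the slacks in `g j * b' j ≤
  -- n λ |b' j|`, all nonnegative. At a minimizer every term vanishes: strict slack off `S` kills
  -- those coordinates, and injectivity settles the rest.
  have hobj : ∀ b', (n:ℝ) * (lassoObjective (design x) y lam b' -
      lassoObjective (design x) y lam b₀) =
      (design x *ᵥ (b' - b₀)) ⬝ᵥ (design x *ᵥ (b' - b₀)) / 2 +
        ∑ j, (n * lam * |b' j| - g j * b' j) := by
    intro b'
    have e1 : ∀ c, ∑ i, (y i - (design x).mulVec c i) ^ 2 =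
        (y - design x *ᵥ c) ⬝ᵥ (y - design x *ᵥ c) := fun c => by
      simp only [dotProduct, Pi.sub_apply, sq]
    have e2 := dotProduct_self_add_sub y (design x *ᵥ b₀) (design x *ᵥ (b' - b₀))
    rw [← mulVec_add, add_sub_cancel] at e2
    have e3 : (y - design x *ᵥ b₀) ⬝ᵥ (design x *ᵥ (b' - b₀)) =
        ∑ j, g j * b' j - ∑ j, n * lam * |b₀ j| := by
      rw [← transpose_mulVec_dotProduct, hD, ← hr, ← hg]
      simp only [dotProduct, Pi.sub_apply, mul_sub, Finset.sum_sub_distrib, hgb]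
    rw [e3] at e2
    simp only [lassoObjective, e1, e2, Finset.sum_sub_distrib, ← Finset.mul_sum]
    field_simp
    ring
  have hnn : ∀ b', (0:ℝ) ≤ (design x *ᵥ (b' - b₀)) ⬝ᵥ (design x *ᵥ (b' - b₀)) := fun b' =>
    Finset.sum_nonneg fun i _ => mul_self_nonneg _
  refine Set.eq_singleton_iff_unique_mem.2 ⟨fun b' => ?_, fun b' hb' => ?_⟩
  · have h1 := hobj b'
    have h2 := Finset.sum_nonneg fun j (_ : j ∈ Finset.univ) => hterm b' j
    have h3 : 0 ≤ (n:ℝ) * (lassoObjective (design x) y lam b' -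
      lassoObjective (design x) y lam b₀) := by rw [h1]; linarith [hnn b']
    linarith [nonneg_of_mul_nonneg_right h3 hn']
  · have h1 := hobj b'
    have h2 := Finset.sum_nonneg fun j (_ : j ∈ Finset.univ) => hterm b' j
    have h3 := hb' b₀
    have h4 : (n:ℝ) * (lassoObjective (design x) y lam b' -
      lassoObjective (design x) y lam b₀) ≤ 0 :=
      mul_nonpos_of_nonneg_of_nonpos hn'.le (by linarith)
    have h5 : ∑ j, (n * lam * |b' j| - g j * b' j) = 0 := by linarith [hnn b']
    have h6 : design x *ᵥ (b' - b₀) = 0 := dotProduct_self_eq_zero.1 (by linarith [hnn b'])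
    have h7 := (Finset.sum_eq_zero_iff_of_nonneg fun j _ => hterm b' j).1 h5
    have h8 : ∀ j, j ∉ S → b' j = 0 := by
      intro j hj
      by_contra hne
      have h9 := h7 j (Finset.mem_univ j)
      have h10 : g j * b' j ≤ |g j| * |b' j| := by rw [← abs_mul]; exact le_abs_self _
      have h11 : |g j| < n * lam := by rw [hgj]; exact hoff j hj
      nlinarith [mul_lt_mul_of_pos_right h11 (abs_pos.2 hne)]
    have h12 : ∀ j, j ∉ S → (b' - b₀) j = 0 := fun j hj => by
      simp [h8 j hj, hb₀, extend, hj]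
    rw [design_mulVec_of_support x h12] at h6
    have h13 := hinj _ h6
    ext j
    by_cases hj : j ∈ S
    · have := congrFun h13 ⟨j, hj⟩
      simpa [sub_eq_zero] using this
    · simpa [sub_eq_zero] using h12 j hj

end Witness

/-! ### Projections, quadratic forms and nets -/

section LinearAlgebra

variable {ι κ : Type*} [Fintype ι] [Fintype κ]

lemma dotProduct_self_nonneg' (u : ι → ℝ) : 0 ≤ u ⬝ᵥ u :=
  Finset.sum_nonneg fun _ _ => mul_self_nonneg _

lemma abs_le_of_dotProduct_self_le {u : ι → ℝ} {c : ℝ} (hc : 0 ≤ c) (h : u ⬝ᵥ u ≤ c ^ 2) (i : ι) :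
    |u i| ≤ c := by
  refine abs_le_of_sq_le_sq (le_trans ?_ h) hc
  rw [sq]
  exact Finset.single_le_sum (f := fun i => u i * u i) (fun _ _ => mul_self_nonneg _)
    (Finset.mem_univ i)

lemma dotProduct_self_le_card_mul {u : ι → ℝ} {c : ℝ} (h : ∀ i, |u i| ≤ c) :
    u ⬝ᵥ u ≤ Fintype.card ι * c ^ 2 := by
  calc u ⬝ᵥ u ≤ ∑ _i : ι, c ^ 2 := Finset.sum_le_sum fun i _ => by
        rw [← abs_mul_abs_self, sq]
        exact mul_self_le_mul_self (abs_nonneg _) (h i)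
    _ = _ := by simp

/-- Replaces the inverse Gram matrix: later arguments solve for the one vector they need. -/
lemma gram_mulVec_surjective [DecidableEq κ] {A : Matrix ι κ ℝ}
    (hA : ∀ h, A *ᵥ h = 0 → h = 0) (v : κ → ℝ) : ∃ w, (Aᵀ * A) *ᵥ w = v := by
  have hinj : Function.Injective (Aᵀ * A).mulVecLin := by
    rw [injective_iff_map_eq_zero]
    intro h hh
    rw [mulVecLin_apply, ← mulVec_mulVec] at hh
    refine hA h (dotProduct_self_eq_zero.1 ?_)
    rw [← transpose_mulVec_dotProduct, hh, zero_dotProduct]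
  exact LinearMap.injective_iff_surjective.1 hinj v

/-- The residual of the Lasso exceeds the noise by at most the squared length of the fitted
dual vector. -/
lemma IsStationary.residual_le [DecidableEq κ] {A : Matrix ι κ ℝ} {e : ι → ℝ} {β b : κ → ℝ}
    {m N : ℝ} (hN : 0 < N) (hA : ∀ h : κ → ℝ, N * (h ⬝ᵥ h) ≤ (A *ᵥ h) ⬝ᵥ (A *ᵥ h))
    (hb : IsStationary A (A *ᵥ β + e) m b) :
    (A *ᵥ β + e - A *ᵥ b) ⬝ᵥ (A *ᵥ β + e - A *ᵥ b) ≤ e ⬝ᵥ e + m ^ 2 * Fintype.card κ / N := by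
  have hinj : ∀ h, A *ᵥ h = 0 → h = 0 := fun h hh => by
    have := hA h
    rw [hh, zero_dotProduct] at this
    exact dotProduct_self_eq_zero.1 (le_antisymm
      (nonpos_of_mul_nonpos_right this hN) (dotProduct_self_nonneg' h))
  set r := A *ᵥ β + e - A *ᵥ b with hr
  -- `A w` is the orthogonal projection of `r` onto the column space of `A`. The component `r - A w`
  -- coincides with that of the noise, so it is no longer than `e`; only the length `T` of the
  -- projection needs the dual bound.
  obtain ⟨w, hw⟩ := gram_mulVec_surjective hinj (Aᵀ *ᵥ r)
  rw [← mulVec_mulVec] at hw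
  have horth : ∀ h, (r - A *ᵥ w) ⬝ᵥ (A *ᵥ h) = 0 := fun h => by
    rw [← transpose_mulVec_dotProduct, mulVec_sub, hw, sub_self, zero_dotProduct]
  set T := (A *ᵥ w) ⬝ᵥ (A *ᵥ w) with hT
  have hT0 : 0 ≤ T := dotProduct_self_nonneg' _
  have hT1 : T ≤ m * ∑ k, |w k| := by
    rw [hT, ← transpose_mulVec_dotProduct, hw, Finset.mul_sum]
    exact Finset.sum_le_sum fun k _ => hb.mul_le k (w k)
  have hT2 : (∑ k, |w k|) ^ 2 ≤ Fintype.card κ * (w ⬝ᵥ w) := by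
    have := sq_sum_le_card_mul_sum_sq (s := Finset.univ) (f := fun k => |w k|)
    simpa [dotProduct, sq] using this
  have hT3 : T ≤ m ^ 2 * Fintype.card κ / N := by
    rcases hT0.eq_or_lt with h0 | h0
    · rw [← h0]; positivity
    rw [le_div_iff₀ hN]
    have h1 : T ^ 2 ≤ m ^ 2 * (Fintype.card κ * (w ⬝ᵥ w)) := by
      calc T ^ 2 ≤ (m * ∑ k, |w k|) ^ 2 := pow_le_pow_left₀ hT0 hT1 2
        _ = m ^ 2 * (∑ k, |w k|) ^ 2 := mul_pow _ _ _
        _ ≤ _ := mul_le_mul_of_nonneg_left hT2 (sq_nonneg m)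
    have h2 : T ^ 2 * N ≤ m ^ 2 * Fintype.card κ * T := by
      calc T ^ 2 * N ≤ m ^ 2 * (Fintype.card κ * (w ⬝ᵥ w)) * N :=
            mul_le_mul_of_nonneg_right h1 hN.le
        _ = m ^ 2 * Fintype.card κ * (N * (w ⬝ᵥ w)) := by ring
        _ ≤ _ := mul_le_mul_of_nonneg_left (hA w) (by positivity)
    have h3 : (T * N) * T ≤ (m ^ 2 * Fintype.card κ) * T := by linarith
    exact le_of_mul_le_mul_right h3 h0
  have hr1 : r ⬝ᵥ r = (r - A *ᵥ w) ⬝ᵥ (r - A *ᵥ w) + T := by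
    have h := horth w
    have e1 : r ⬝ᵥ r = (r - A *ᵥ w + A *ᵥ w) ⬝ᵥ (r - A *ᵥ w + A *ᵥ w) := by simp
    rw [e1, add_dotProduct, dotProduct_add, dotProduct_add, h,
      dotProduct_comm (A *ᵥ w) (r - A *ᵥ w), h]
    ring
  have he : e = (r - A *ᵥ w) + A *ᵥ (w + b - β) := by
    rw [hr, mulVec_sub, mulVec_add]; abel
  have he1 : (r - A *ᵥ w) ⬝ᵥ (r - A *ᵥ w) ≤ e ⬝ᵥ e := by
    have h := horth (w + b - β)
    rw [he, add_dotProduct, dotProduct_add, dotProduct_add, h,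
      dotProduct_comm (A *ᵥ (w + b - β)) (r - A *ᵥ w), h]
    linarith [dotProduct_self_nonneg' (A *ᵥ (w + b - β))]
  linarith

/-- Subtract the bounds for the form at `a u + v` and `a u - v`. The free weight `a` balances
vectors of different lengths. -/
lemma polarization_bound {M : Matrix κ κ ℝ} (hM : M.IsSymm) {δ : ℝ}
    (hδ : ∀ h : κ → ℝ, |h ⬝ᵥ (M *ᵥ h)| ≤ δ * (h ⬝ᵥ h)) (u v : κ → ℝ) (a : ℝ) :
    2 * a * (u ⬝ᵥ (M *ᵥ v)) ≤ δ * (a ^ 2 * (u ⬝ᵥ u) + v ⬝ᵥ v) := by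
  have hs : v ⬝ᵥ (M *ᵥ u) = u ⬝ᵥ (M *ᵥ v) := by
    rw [dotProduct_mulVec, ← mulVec_transpose, hM.eq, dotProduct_comm]
  have h1 := (abs_le.1 (hδ (a • u + v))).2
  have h2 := (abs_le.1 (hδ (a • u - v))).1
  simp only [mulVec_add, mulVec_sub, mulVec_smul, add_dotProduct, sub_dotProduct, dotProduct_add,
    dotProduct_sub, smul_dotProduct, dotProduct_smul, smul_eq_mul, hs, dotProduct_comm v u] at h1 h2
  nlinarith

lemma mulVec_dotProduct_self_le {M : Matrix κ κ ℝ} (hM : M.IsSymm) {δ : ℝ} (hδ0 : 0 ≤ δ)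
    (hδ : ∀ h : κ → ℝ, |h ⬝ᵥ (M *ᵥ h)| ≤ δ * (h ⬝ᵥ h)) (h : κ → ℝ) :
    (M *ᵥ h) ⬝ᵥ (M *ᵥ h) ≤ δ ^ 2 * (h ⬝ᵥ h) := by
  -- The weight `a = δ⁻¹` is optimal for the pair `M h`, `h`; the case `δ = 0` is separate.
  have key := fun a => polarization_bound hM hδ (M *ᵥ h) h a
  rcases hδ0.eq_or_lt with h0 | h0
  · have := key 1
    rw [← h0] at this ⊢
    nlinarith
  · have := key δ⁻¹
    have e : δ * (δ⁻¹ ^ 2 * ((M *ᵥ h) ⬝ᵥ (M *ᵥ h)) + h ⬝ᵥ h) =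
        δ⁻¹ * ((M *ᵥ h) ⬝ᵥ (M *ᵥ h)) + δ * (h ⬝ᵥ h) := by field_simp
    rw [e] at this
    have h2 : δ⁻¹ * ((M *ᵥ h) ⬝ᵥ (M *ᵥ h)) ≤ δ * (h ⬝ᵥ h) := by linarith
    rw [inv_mul_le_iff₀ h0] at h2
    linarith

/-- A bound for a quadratic form on a `1/2`-net of the sphere extends to the whole space. -/
lemma quadForm_le_of_net {M : Matrix κ κ ℝ} (hM : M.IsSymm) {t : ℝ} {N : Finset (κ → ℝ)}
    (hN1 : ∀ k ∈ N, k ⬝ᵥ k = 1)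
    (hN : ∀ h : κ → ℝ, h ⬝ᵥ h = 1 → ∃ k ∈ N, (h - k) ⬝ᵥ (h - k) ≤ 1 / 4)
    (ht : ∀ k ∈ N, |k ⬝ᵥ (M *ᵥ k)| ≤ t) (h : κ → ℝ) :
    |h ⬝ᵥ (M *ᵥ h)| ≤ 32 * t * (h ⬝ᵥ h) := by
  have hdc : Continuous fun h : κ → ℝ => h ⬝ᵥ h := continuous_id.dotProduct continuous_id
  have hqc : Continuous fun h : κ → ℝ => |h ⬝ᵥ (M *ᵥ h)| :=
    (continuous_id.dotProduct (continuous_const.matrix_mulVec continuous_id)).abs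
  have hcomp : IsCompact {h : κ → ℝ | h ⬝ᵥ h = 1} := by
    refine Metric.isCompact_of_isClosed_isBounded (isClosed_eq hdc continuous_const) ?_
    refine isBounded_iff_forall_norm_le.2 ⟨1, fun h hh => ?_⟩
    exact (pi_norm_le_iff_of_nonneg zero_le_one).2
      (abs_le_of_dotProduct_self_le zero_le_one (by rw [show h ⬝ᵥ h = 1 from hh]; norm_num))
  have hscale : ∀ h : κ → ℝ, h ⬝ᵥ h ≠ 0 →
      ((√(h ⬝ᵥ h))⁻¹ • h) ⬝ᵥ ((√(h ⬝ᵥ h))⁻¹ • h) = 1 := fun h hh => by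
    rw [smul_dotProduct, dotProduct_smul, smul_eq_mul, smul_eq_mul, ← mul_assoc, ← mul_inv,
      Real.mul_self_sqrt (dotProduct_self_nonneg' h), inv_mul_cancel₀ hh]
  rcases eq_or_ne (h ⬝ᵥ h) 0 with h0 | h0
  · rw [dotProduct_self_eq_zero.1 h0]; simp
  obtain ⟨g, hg, hgmax⟩ := hcomp.exists_isMaxOn ⟨_, hscale h h0⟩ hqc.continuousOn
  set D := |g ⬝ᵥ (M *ᵥ g)| with hD
  have hall : ∀ h : κ → ℝ, |h ⬝ᵥ (M *ᵥ h)| ≤ D * (h ⬝ᵥ h) := fun h => by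
    rcases eq_or_ne (h ⬝ᵥ h) 0 with h0 | h0
    · rw [dotProduct_self_eq_zero.1 h0]; simp
    have h1 := hgmax (hscale h h0)
    have hpos : 0 < h ⬝ᵥ h := lt_of_le_of_ne (dotProduct_self_nonneg' h) h0.symm
    simp only [Set.mem_ofPred_eq, mulVec_smul, smul_dotProduct, dotProduct_smul, smul_eq_mul] at h1
    rw [← mul_assoc, ← mul_inv, Real.mul_self_sqrt hpos.le, abs_mul, abs_of_pos (inv_pos.2 hpos),
      inv_mul_le_iff₀ hpos] at h1
    linarith
  have hD0 : 0 ≤ D := abs_nonneg _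
  obtain ⟨k, hk, hgk⟩ := hN g hg
  have hg1 : g ⬝ᵥ g = 1 := hg
  have hk1 := hN1 k hk
  have hs : k ⬝ᵥ (M *ᵥ g) = g ⬝ᵥ (M *ᵥ k) := by
    rw [dotProduct_mulVec, ← mulVec_transpose, hM.eq, dotProduct_comm]
  -- The difference of the forms at `g` and `k` is the bilinear form at `g - k`, `g + k`. With `d`
  -- the squared length of `g - k`, that of `g + k` is `4 - d`, so `a² = 16` and `d ≤ 1/4` give `16
  -- d + 4 - d ≤ 31/4`. Hence the difference is at most `31/32 D`, whence `D ≤ t + 31/32 D` and the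
  -- factor `32`.
  have hb : ∀ a : ℝ, (a = 4 ∨ a = -4) →
      2 * a * (g ⬝ᵥ (M *ᵥ g) - k ⬝ᵥ (M *ᵥ k)) ≤ 31 / 4 * D := by
    intro a ha
    have ha2 : a ^ 2 = 16 := by rcases ha with rfl | rfl <;> norm_num
    have h1 := polarization_bound hM hall (g - k) (g + k) a
    rw [ha2] at h1
    simp only [mulVec_add, sub_dotProduct, add_dotProduct, dotProduct_add, dotProduct_sub, hs,
      dotProduct_comm k g, hg1, hk1] at h1 hgk
    nlinarith
  have h1 := hb 4 (Or.inl rfl)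
  have h2 := hb (-4) (Or.inr rfl)
  have h3 := abs_le.1 (ht k hk)
  have hDt : D ≤ 32 * t := by
    rcases abs_cases (g ⬝ᵥ (M *ᵥ g)) with ⟨h4, _⟩ | ⟨h4, _⟩ <;> rw [← hD] at h4 <;> linarith
  exact (hall h).trans (mul_le_mul_of_nonneg_right hDt (dotProduct_self_nonneg' h))

/-- The unit sphere has a `1/2`-net with at most `5 ^ d` points. -/
lemma exists_sphere_net (κ : Type*) [Fintype κ] :
    ∃ N : Finset (κ → ℝ), N.card ≤ 5 ^ Fintype.card κ ∧ (∀ k ∈ N, k ⬝ᵥ k = 1) ∧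
      ∀ h : κ → ℝ, h ⬝ᵥ h = 1 → ∃ k ∈ N, (h - k) ⬝ᵥ (h - k) ≤ 1 / 4 := by
  classical
  let Sep : ℕ → Prop := fun c => ∃ N : Finset (κ → ℝ), N.card = c ∧ (∀ k ∈ N, k ⬝ᵥ k = 1) ∧
    ∀ k ∈ N, ∀ l ∈ N, k ≠ l → 1 / 4 ≤ (k - l) ⬝ᵥ (k - l)
  have hnorm : ∀ u : κ → ℝ, ‖(WithLp.toLp 2 ((2:ℝ) • u) : EuclideanSpace ℝ κ)‖ ^ 2 =
      4 * (u ⬝ᵥ u) := fun u => by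
    rw [EuclideanSpace.real_norm_sq_eq]
    simp only [dotProduct, Finset.mul_sum]
    exact Finset.sum_congr rfl fun i _ => by simp; ring
  have hcard : ∀ N : Finset (κ → ℝ), (∀ k ∈ N, k ⬝ᵥ k = 1) →
      (∀ k ∈ N, ∀ l ∈ N, k ≠ l → 1 / 4 ≤ (k - l) ⬝ᵥ (k - l)) → N.card ≤ 5 ^ Fintype.card κ := by
    intro N h1 h2
    have hinj : Function.Injective
        (fun u : κ → ℝ => (WithLp.toLp 2 ((2:ℝ) • u) : EuclideanSpace ℝ κ)) := fun u v huv => by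
      have := WithLp.toLp_injective 2 huv
      exact smul_right_injective _ (two_ne_zero) this
    -- Doubling turns a `1/2`-separated subset of the unit sphere into a `1`-separated subset of the
    -- ball of radius `2`, the normalization of the volume bound `5 ^ d`.
    rw [← Finset.card_image_of_injective N hinj, ← finrank_euclideanSpace (𝕜 := ℝ) (ι := κ)]
    refine Besicovitch.card_le_of_separated _ ?_ ?_
    · intro c hc
      obtain ⟨k, hk, rfl⟩ := Finset.mem_image.1 hc
      refine abs_le_of_sq_le_sq' ?_ (by norm_num) |>.2
      rw [hnorm, h1 k hk]; norm_num
    · intro c hc d hd hcd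
      obtain ⟨k, hk, rfl⟩ := Finset.mem_image.1 hc
      obtain ⟨l, hl, rfl⟩ := Finset.mem_image.1 hd
      have hkl : k ≠ l := fun h => hcd (by rw [h])
      refine le_of_sq_le_sq ?_ (norm_nonneg _)
      rw [← WithLp.toLp_sub, ← smul_sub, hnorm]
      linarith [h2 k hk l hl hkl]
  have hSep0 : Sep 0 := ⟨∅, by simp⟩
  -- A separated set of maximal cardinality is a net: a point far from all of it could be added.
  obtain ⟨N, hNc, hN1, hN2⟩ := Nat.findGreatest_spec (P := Sep) (Nat.zero_le (5 ^ Fintype.card κ)) hSep0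
  refine ⟨N, hcard N hN1 hN2, hN1, fun h hh => ?_⟩
  by_contra hcon
  push Not at hcon
  have hnot : h ∉ N := fun hm => by
    have := hcon h hm
    simp at this
    linarith
  have hsep : Sep (N.card + 1) := by
    refine ⟨insert h N, Finset.card_insert_of_notMem hnot, ?_, ?_⟩
    · intro k hk
      rcases Finset.mem_insert.1 hk with rfl | hk
      exacts [hh, hN1 k hk]
    · intro k hk l hl hkl
      rw [Finset.mem_insert] at hk hl
      rcases hk with rfl | hk <;> rcases hl with rfl | hl
      · exact absurd rfl hkl
      · exact (hcon l hl).le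
      · rw [← neg_sub, neg_dotProduct, dotProduct_neg, neg_neg]
        exact (hcon k hk).le
      · exact hN2 k hk l hl hkl
  have hle : N.card + 1 ≤ 5 ^ Fintype.card κ := by
    obtain ⟨N', h1, h2, h3⟩ := hsep
    rw [← h1]; exact hcard N' h2 h3
  have := Nat.le_findGreatest hle hsep
  omega

end LinearAlgebra

/-! ### The maximal absolute row sum -/

section InfNorm

variable {ι κ : Type*} [Fintype ι] [Fintype κ]

lemma sum_abs_le_infNorm (A : Matrix ι κ ℝ) (i : ι) : ∑ j, |A i j| ≤ infNorm A := by
  have h : infNorm A = ((Finset.univ : Finset ι).sup fun i : ι => ∑ j : κ, ‖A i j‖₊ : NNReal) :=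
    Matrix.linfty_opNorm_def A
  rw [h]
  have h2 := Finset.le_sup (f := fun i : ι => ∑ j : κ, ‖A i j‖₊) (Finset.mem_univ i)
  have h3 : ((∑ j : κ, ‖A i j‖₊ : NNReal) : ℝ) = ∑ j, |A i j| := by
    push_cast; rfl
  rw [← h3]
  exact_mod_cast h2

lemma infNorm_nonneg (A : Matrix ι κ ℝ) : 0 ≤ infNorm A := by
  have h : infNorm A = ((Finset.univ : Finset ι).sup fun i : ι => ∑ j : κ, ‖A i j‖₊ : NNReal) :=
    Matrix.linfty_opNorm_def A
  rw [h]
  exact NNReal.coe_nonneg _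

lemma abs_dotProduct_le {u v : ι → ℝ} {c : ℝ} (hv : ∀ i, |v i| ≤ c) :
    |u ⬝ᵥ v| ≤ (∑ i, |u i|) * c := by
  rw [Finset.sum_mul]
  refine (Finset.abs_sum_le_sum_abs _ _).trans (Finset.sum_le_sum fun i _ => ?_)
  rw [abs_mul]
  exact mul_le_mul_of_nonneg_left (hv i) (abs_nonneg _)

lemma abs_mulVec_le (A : Matrix ι κ ℝ) {v : κ → ℝ} {c : ℝ} (hc : 0 ≤ c) (hv : ∀ k, |v k| ≤ c)
    (i : ι) : |(A *ᵥ v) i| ≤ infNorm A * c :=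
  (abs_dotProduct_le hv).trans (mul_le_mul_of_nonneg_right (sum_abs_le_infNorm A i) hc)

end InfNorm

/-! ### The inverse Gram matrix in sup norm, by whitening -/

section Whitening

variable {ι κ : Type*} [Fintype ι] [Fintype κ] [DecidableEq κ]

lemma isSymm_whitened {R : Matrix κ κ ℝ} (hR : R.IsSymm) (A : Matrix ι κ ℝ) (N : ℝ) :
    (N⁻¹ • (R * (Aᵀ * A) * R) - 1).IsSymm := by
  unfold Matrix.IsSymm
  rw [transpose_sub, transpose_smul, transpose_one, transpose_mul, transpose_mul,
    transpose_mul, transpose_transpose, hR.eq, Matrix.mul_assoc R]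

lemma whitened_quadForm {R : Matrix κ κ ℝ} (hR : R.IsSymm) (A : Matrix ι κ ℝ) (N : ℝ)
    (h : κ → ℝ) :
    h ⬝ᵥ ((N⁻¹ • (R * (Aᵀ * A) * R) - 1) *ᵥ h) =
      N⁻¹ * ((A *ᵥ (R *ᵥ h)) ⬝ᵥ (A *ᵥ (R *ᵥ h))) - h ⬝ᵥ h := by
  have e : h ⬝ᵥ ((R * (Aᵀ * A) * R) *ᵥ h) = (A *ᵥ (R *ᵥ h)) ⬝ᵥ (A *ᵥ (R *ᵥ h)) := by
    rw [← transpose_mulVec_dotProduct A, ← transpose_mulVec_dotProduct R, hR.eq,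
      dotProduct_comm]
    simp only [mulVec_mulVec, Matrix.mul_assoc]
  rw [sub_mulVec, one_mulVec, dotProduct_sub, smul_mulVec, dotProduct_smul, smul_eq_mul, e]

lemma whitened_dotProduct {Q R : Matrix κ κ ℝ} (hR : R.IsSymm) (hRRQ : R * R * Q = 1)
    (h : κ → ℝ) : (R *ᵥ h) ⬝ᵥ (Q *ᵥ (R *ᵥ h)) = h ⬝ᵥ h := by
  have hRQR : R * Q * R = 1 := by
    rw [mul_assoc] at hRRQ
    exact mul_eq_one_comm.1 hRRQ
  nth_rewrite 1 [← hR.eq]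
  rw [transpose_mulVec_dotProduct, mulVec_mulVec, mulVec_mulVec, hRQR, one_mulVec]

/-- If the whitened Gram matrix of `A` is `δ`-close to the identity, then the inverse Gram matrix
maps the unit cube into a cube governed by `‖R‖_∞²`. -/
lemma abs_le_of_gram_mulVec_eq {A : Matrix ι κ ℝ} {Q R : Matrix κ κ ℝ}
    (hR : R.IsSymm) (hRRQ : R * R * Q = 1) {N δ : ℝ} (hN : 0 < N) (hδ0 : 0 ≤ δ) (hδ1 : δ ≤ 1 / 2)
    (hA : ∀ h : κ → ℝ, |(A *ᵥ h) ⬝ᵥ (A *ᵥ h) - N * (h ⬝ᵥ (Q *ᵥ h))| ≤ N * δ * (h ⬝ᵥ (Q *ᵥ h)))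
    {v z : κ → ℝ} (hz : ∀ k, |z k| ≤ 1) (hv : (Aᵀ * A) *ᵥ v = N • z) (k : κ) :
    |v k| ≤ (1 + 2 * δ * √(Fintype.card κ)) * infNorm R ^ 2 := by
  set M : Matrix κ κ ℝ := N⁻¹ • (R * (Aᵀ * A) * R) - 1 with hMdef
  have hM : M.IsSymm := isSymm_whitened hR A N
  have hq : ∀ h : κ → ℝ, |h ⬝ᵥ (M *ᵥ h)| ≤ δ * (h ⬝ᵥ h) := fun h => by
    have h1 := hA (R *ᵥ h)
    rw [whitened_dotProduct hR hRRQ] at h1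
    rw [whitened_quadForm hR]
    have e3 : N⁻¹ * ((A *ᵥ (R *ᵥ h)) ⬝ᵥ (A *ᵥ (R *ᵥ h))) - h ⬝ᵥ h =
      N⁻¹ * ((A *ᵥ (R *ᵥ h)) ⬝ᵥ (A *ᵥ (R *ᵥ h)) - N * (h ⬝ᵥ h)) := by field_simp
    rw [e3, abs_mul, abs_of_pos (inv_pos.2 hN), inv_mul_le_iff₀ hN]
    linarith
  -- Since `R R Q = 1`, this is `R⁻¹ v`. In these coordinates the Gram equation reads `(1 + M) h = R
  -- z`, a small perturbation of the identity.
  set h := R *ᵥ (Q *ᵥ v) with hh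
  have hvh : v = R *ᵥ h := by
    rw [hh, mulVec_mulVec, mulVec_mulVec, hRRQ, one_mulVec]
  have hMh : h = R *ᵥ z - M *ᵥ h := by
    rw [hMdef, sub_mulVec, one_mulVec, smul_mulVec, ← mulVec_mulVec, ← hvh, ← mulVec_mulVec, hv,
      mulVec_smul, smul_smul, inv_mul_cancel₀ hN.ne', one_smul]
    abel
  set ρ := infNorm R
  have hρ : 0 ≤ ρ := infNorm_nonneg R
  set s : ℝ := (Fintype.card κ : ℝ)
  have hs : 0 ≤ s := Nat.cast_nonneg _
  have hg : ∀ k, |(R *ᵥ z) k| ≤ ρ := fun k => by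
    simpa using abs_mulVec_le R zero_le_one hz k
  have hg2 : (R *ᵥ z) ⬝ᵥ (R *ᵥ z) ≤ s * ρ ^ 2 := dotProduct_self_le_card_mul hg
  have hMh2 := mulVec_dotProduct_self_le hM hδ0 hq h
  -- The perturbation is controlled only in `ℓ²`: `|h|₂ ≤ 2 |R z|₂` because `δ ≤ 1/2`, and `|R z|₂ ≤
  -- √s ρ`. This passage between norms is the source of `√s`.
  have hh2 : h ⬝ᵥ h ≤ 4 * (s * ρ ^ 2) := by
    have h1 : (R *ᵥ z) = h + M *ᵥ h := by nth_rewrite 1 [hMh]; abel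
    have h2 : 2 * (h ⬝ᵥ (M *ᵥ h)) ≥ - (1 / 2 * (h ⬝ᵥ h) + 2 * ((M *ᵥ h) ⬝ᵥ (M *ᵥ h))) := by
      have := dotProduct_self_nonneg' (h + (2:ℝ) • (M *ᵥ h))
      simp only [add_dotProduct, dotProduct_add, smul_dotProduct, dotProduct_smul, smul_eq_mul,
        dotProduct_comm (M *ᵥ h) h] at this
      nlinarith
    have h3 : (R *ᵥ z) ⬝ᵥ (R *ᵥ z) = h ⬝ᵥ h + 2 * (h ⬝ᵥ (M *ᵥ h)) + (M *ᵥ h) ⬝ᵥ (M *ᵥ h) := by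
      rw [h1]
      simp only [add_dotProduct, dotProduct_add, dotProduct_comm (M *ᵥ h) h]
      ring
    have h5 : δ ^ 2 * (h ⬝ᵥ h) ≤ 1 / 4 * (h ⬝ᵥ h) :=
      mul_le_mul_of_nonneg_right (by nlinarith) (dotProduct_self_nonneg' h)
    linarith
  have hMk : ∀ k, |(M *ᵥ h) k| ≤ 2 * δ * √s * ρ := fun k => by
    refine abs_le_of_dotProduct_self_le (by positivity) (hMh2.trans ?_) k
    calc δ ^ 2 * (h ⬝ᵥ h) ≤ δ ^ 2 * (4 * (s * ρ ^ 2)) :=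
          mul_le_mul_of_nonneg_left hh2 (sq_nonneg _)
      _ = (2 * δ * √s * ρ) ^ 2 := by
          rw [mul_pow, mul_pow, mul_pow, Real.sq_sqrt hs]; ring
  have hhk : ∀ k, |h k| ≤ (1 + 2 * δ * √s) * ρ := fun k => by
    rw [hMh, Pi.sub_apply]
    refine (abs_sub _ _).trans ?_
    linarith [hg k, hMk k]
  rw [hvh]
  refine (abs_mulVec_le R (by positivity) hhk k).trans (le_of_eq ?_)
  ring

end Whitening

/-! ### Gaussian and chi-square tail bounds -/

section Tails

variable {n : ℕ}

lemma integrable_exp_mul_sq_gaussianReal {l : ℝ} (hl : l < 1 / 2) :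
    Integrable (fun x => Real.exp (l * x ^ 2)) (gaussianReal 0 1) := by
  rw [gaussianReal_of_var_ne_zero _ one_ne_zero, gaussianPDF_def,
    integrable_withDensity_iff (by fun_prop) (by simp)]
  have h1 : (fun x : ℝ => Real.exp (l * x ^ 2) * (ENNReal.ofReal (gaussianPDFReal 0 1 x)).toReal) =
      fun x => (√(2 * Real.pi))⁻¹ * Real.exp (-(1 / 2 - l) * x ^ 2) := by
    ext x
    rw [ENNReal.toReal_ofReal (gaussianPDFReal_nonneg 0 1 x), gaussianPDFReal]
    simp only [NNReal.coe_one, mul_one, sub_zero]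
    rw [mul_left_comm, ← Real.exp_add]
    congr 2
    ring
  rw [h1]
  exact (integrable_exp_neg_mul_sq (by linarith)).const_mul _

lemma integral_exp_mul_sq_gaussianReal {l : ℝ} (hl : l < 1 / 2) :
    ∫ x, Real.exp (l * x ^ 2) ∂(gaussianReal 0 1) = √(1 / (1 - 2 * l)) := by
  rw [integral_gaussianReal_eq_integral_smul one_ne_zero]
  have h1 : (fun x : ℝ => gaussianPDFReal 0 1 x • Real.exp (l * x ^ 2)) =
      fun x => (√(2 * Real.pi))⁻¹ * Real.exp (-(1 / 2 - l) * x ^ 2) := by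
    ext x
    rw [gaussianPDFReal, smul_eq_mul]
    simp only [NNReal.coe_one, mul_one, sub_zero]
    rw [mul_assoc, ← Real.exp_add]
    congr 2
    ring
  rw [h1, integral_const_mul, integral_gaussian, ← Real.sqrt_inv, ← Real.sqrt_mul (by positivity)]
  congr 1
  have : 1 - 2 * l ≠ 0 := by linarith
  have : 1 / 2 - l ≠ 0 := by linarith
  field_simp

/-- The left side is the moment generating function of a squared standard normal. Allowing negative
`l` lets one bound serve both chi-square tails. -/
lemma sqrt_one_div_le_exp {l : ℝ} (hl : l ≤ 1 / 4) :
    √(1 / (1 - 2 * l)) ≤ Real.exp (l + 2 * l ^ 2) := by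
  rw [Real.sqrt_le_left (Real.exp_pos _).le, ← Real.exp_nat_mul,
    div_le_iff₀ (by linarith)]
  rcases le_total 0 l with h0 | h0
  · have h3 := Real.quadratic_le_exp_of_nonneg (show 0 ≤ ((2:ℕ):ℝ) * (l + 2 * l ^ 2) by positivity)
    have h4 : 0 ≤ 1 - 2 * l := by linarith
    refine le_trans ?_ (mul_le_mul_of_nonneg_right h3 h4)
    push_cast
    have h5 : 0 ≤ l ^ 2 * (1 / 4 - l) := mul_nonneg (sq_nonneg l) (by linarith)
    have h6 : 0 ≤ l ^ 3 * (1 / 4 - l) := mul_nonneg (pow_nonneg h0 3) (by linarith)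
    have h7 : 0 ≤ l ^ 4 * (1 / 4 - l) := mul_nonneg (pow_nonneg h0 4) (by linarith)
    have h8 : 0 ≤ l ^ 3 := pow_nonneg h0 3
    have h9 : 0 ≤ l ^ 4 := pow_nonneg h0 4
    nlinarith [sq_nonneg l]
  · have h3 := Real.add_one_le_exp (((2:ℕ):ℝ) * (l + 2 * l ^ 2))
    have h4 : 0 ≤ 1 - 2 * l := by linarith
    refine le_trans ?_ (mul_le_mul_of_nonneg_right h3 h4)
    push_cast
    nlinarith [mul_nonneg (sq_nonneg l) (neg_nonneg.2 h0)]

/-- Chernoff bound for a separable statistic of independent coordinates. -/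
lemma measureReal_pi_le_of_mgf_le {μ : Measure ℝ} [IsProbabilityMeasure μ] (f : Fin n → ℝ → ℝ)
    {t a : ℝ} {K : Fin n → ℝ} (ht : 0 ≤ t)
    (hint : ∀ i, Integrable (fun x => Real.exp (t * f i x)) μ)
    (hK : ∀ i, ∫ x, Real.exp (t * f i x) ∂μ ≤ Real.exp (K i)) :
    (Measure.pi fun _ : Fin n => μ).real {x | a ≤ ∑ i, f i (x i)} ≤
      Real.exp (-t * a + ∑ i, K i) := by
  have he : (fun x : Fin n → ℝ => Real.exp (t * ∑ i, f i (x i))) =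
      fun x => ∏ i, Real.exp (t * f i (x i)) := by
    ext x; rw [Finset.mul_sum, Real.exp_sum]
  have h1 : Integrable (fun x : Fin n → ℝ => Real.exp (t * ∑ i, f i (x i)))
      (Measure.pi fun _ : Fin n => μ) := by
    rw [he]
    exact Integrable.fintype_prod (f := fun i x => Real.exp (t * f i x)) hint
  refine (measure_ge_le_exp_mul_mgf a ht h1).trans ?_
  rw [Real.exp_add]
  refine mul_le_mul_of_nonneg_left ?_ (Real.exp_pos _).le
  rw [mgf, he, integral_fintype_prod_eq_prod (f := fun i x => Real.exp (t * f i x)), Real.exp_sum]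
  exact Finset.prod_le_prod (fun i _ => integral_nonneg fun x => (Real.exp_pos _).le)
    fun i _ => hK i

/-- Gaussian tail bound for a linear form of i.i.d. centered Gaussian variables. -/
lemma measure_le_abs_dotProduct {v : ℝ≥0} (c : Fin n → ℝ) {a l : ℝ} (ha : 0 < a) (hl : 0 ≤ l)
    (h : 2 * v * (c ⬝ᵥ c) * l ≤ a ^ 2) :
    (Measure.pi fun _ : Fin n => gaussianReal 0 v).real {x | a ≤ |c ⬝ᵥ x|} ≤
      2 * Real.exp (-l) := by
  have key : ∀ d : Fin n → ℝ, d ⬝ᵥ d = c ⬝ᵥ c →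
      (Measure.pi fun _ : Fin n => gaussianReal 0 v).real {x | a ≤ d ⬝ᵥ x} ≤ Real.exp (-l) := by
    intro d hd
    -- This Chernoff parameter does not divide by the variance, so a degenerate linear form needs no
    -- separate treatment.
    set t := 2 * l / a with ht
    have hmgf : ∀ i, ∫ x, Real.exp (t * (d i * x)) ∂(gaussianReal 0 v) =
        Real.exp (v * (t * d i) ^ 2 / 2) := fun i => by
      have := congrFun (mgf_id_gaussianReal (μ := 0) (v := v)) (t * d i)
      rw [mgf] at this
      simpa [mul_assoc] using this
    have hint : ∀ i, Integrable (fun x => Real.exp (t * (d i * x))) (gaussianReal 0 v) :=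
      fun i => by
        simpa [mul_assoc] using integrable_exp_mul_gaussianReal (μ := 0) (v := v) (t * d i)
    refine (measureReal_pi_le_of_mgf_le (fun i x => d i * x) (by positivity) hint
      fun i => (hmgf i).le).trans (Real.exp_le_exp.2 ?_)
    have h1 : ∑ i, (v:ℝ) * (t * d i) ^ 2 / 2 = v * (c ⬝ᵥ c) * t ^ 2 / 2 := by
      rw [← hd]
      simp only [dotProduct, Finset.mul_sum, Finset.sum_mul, Finset.sum_div]
      exact Finset.sum_congr rfl fun i _ => by ring
    have h2 : t * a = 2 * l := by rw [ht]; field_simp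
    have h3 : v * (c ⬝ᵥ c) * t ^ 2 / 2 ≤ l := by
      have : v * (c ⬝ᵥ c) * t ^ 2 / 2 = (2 * v * (c ⬝ᵥ c) * l) * l / a ^ 2 := by
        rw [ht]; field_simp
      rw [this, div_le_iff₀ (by positivity)]
      nlinarith [mul_le_mul_of_nonneg_right h hl]
    rw [h1]
    linarith
  have hsub : {x : Fin n → ℝ | a ≤ |c ⬝ᵥ x|} ⊆ {x | a ≤ c ⬝ᵥ x} ∪ {x | a ≤ (-c) ⬝ᵥ x} := by
    intro x hx
    rcases le_abs.1 (show a ≤ |c ⬝ᵥ x| from hx) with h | h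
    · exact Or.inl h
    · exact Or.inr (by simpa using h)
  refine (measureReal_mono hsub).trans ((measureReal_union_le _ _).trans ?_)
  linarith [key c rfl, key (-c) (by simp)]

lemma measure_dotProduct_self_ge {t : ℝ} (ht0 : 0 ≤ t) (ht1 : t ≤ 1) :
    (Measure.pi fun _ : Fin n => gaussianReal 0 1).real {x | n * (1 + t) ≤ x ⬝ᵥ x} ≤
      Real.exp (-(n * t ^ 2 / 8)) := by
  have hs : ∀ x : Fin n → ℝ, x ⬝ᵥ x = ∑ i, (x i) ^ 2 := fun x => by simp [dotProduct, sq]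
  simp only [hs]
  -- With parameter `t / 4` the exponent is `-n t (1 + t) / 4 + n (t / 4 + t² / 8) = -n t² / 8`.
  refine (measureReal_pi_le_of_mgf_le (fun _ x => x ^ 2) (t := t / 4)
    (K := fun _ => t / 4 + 2 * (t / 4) ^ 2) (by positivity)
    (fun _ => integrable_exp_mul_sq_gaussianReal (by linarith)) fun _ => ?_).trans
    (Real.exp_le_exp.2 (le_of_eq ?_))
  · rw [integral_exp_mul_sq_gaussianReal (by linarith)]
    exact sqrt_one_div_le_exp (by linarith)
  · simp; ring

lemma measure_dotProduct_self_le {t : ℝ} (ht0 : 0 ≤ t) :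
    (Measure.pi fun _ : Fin n => gaussianReal 0 1).real {x | x ⬝ᵥ x ≤ n * (1 - t)} ≤
      Real.exp (-(n * t ^ 2 / 8)) := by
  have hs : ∀ x : Fin n → ℝ, (x ⬝ᵥ x ≤ n * (1 - t)) ↔ -(n * (1 - t)) ≤ ∑ i, -(x i) ^ 2 :=
    fun x => by rw [Finset.sum_neg_distrib, neg_le_neg_iff]; simp [dotProduct, sq]
  simp only [hs]
  refine (measureReal_pi_le_of_mgf_le (fun _ x => -x ^ 2) (t := t / 4)
    (K := fun _ => -(t / 4) + 2 * (-(t / 4)) ^ 2) (by positivity)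
    (fun _ => ?_) fun _ => ?_).trans (Real.exp_le_exp.2 (le_of_eq ?_))
  · simpa using integrable_exp_mul_sq_gaussianReal (l := -(t / 4)) (by linarith)
  · have := integral_exp_mul_sq_gaussianReal (l := -(t / 4)) (by linarith)
    simp only [mul_neg, ← neg_mul]
    rw [this]
    exact sqrt_one_div_le_exp (by linarith)
  · simp; ring

/-- Concentration of the `χ²` distribution. -/
lemma measure_abs_dotProduct_self_sub_ge {t : ℝ} (ht0 : 0 ≤ t) (ht1 : t ≤ 1) :
    (Measure.pi fun _ : Fin n => gaussianReal 0 1).real {x | n * t ≤ |x ⬝ᵥ x - n|} ≤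
      2 * Real.exp (-(n * t ^ 2 / 8)) := by
  have hsub : {x : Fin n → ℝ | n * t ≤ |x ⬝ᵥ x - n|} ⊆
      {x | n * (1 + t) ≤ x ⬝ᵥ x} ∪ {x | x ⬝ᵥ x ≤ n * (1 - t)} := by
    intro x hx
    rcases le_abs.1 (show n * t ≤ |x ⬝ᵥ x - n| from hx) with h | h
    · exact Or.inl (show (n:ℝ) * (1 + t) ≤ x ⬝ᵥ x by linarith)
    · exact Or.inr (show x ⬝ᵥ x ≤ (n:ℝ) * (1 - t) by linarith)
  refine (measureReal_mono hsub).trans ((measureReal_union_le _ _).trans ?_)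
  linarith [measure_dotProduct_self_ge (n := n) ht0 ht1, measure_dotProduct_self_le (n := n) ht0]

/-- The upper chi-square tail at `t = 1`, after scaling. The strict inequality makes the event empty
when `σ = 0`. -/
lemma measure_noise_gt {σ : ℝ} :
    (Measure.pi fun _ : Fin n => gaussianReal 0 (σ ^ 2).toNNReal).real
      {e | 2 * n * σ ^ 2 < e ⬝ᵥ e} ≤ Real.exp (-(1 / 8 * n)) := by
  have hg : gaussianReal 0 (σ ^ 2).toNNReal = (gaussianReal 0 1).map (σ * ·) := by
    rw [gaussianReal_map_const_mul, mul_zero, mul_one]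
    congr 1
    ext
    simp [Real.coe_toNNReal _ (sq_nonneg σ)]
  have hmap : (Measure.pi fun _ : Fin n => gaussianReal 0 (σ ^ 2).toNNReal) =
      (Measure.pi fun _ : Fin n => gaussianReal 0 1).map fun x i => σ * x i := by
    rw [Measure.pi_map_pi (fun _ => by fun_prop)]
    simp only [hg]
  have hmeas : MeasurableSet {e : Fin n → ℝ | 2 * n * σ ^ 2 < e ⬝ᵥ e} :=
    measurableSet_lt measurable_const (continuous_id.dotProduct continuous_id).measurable
  rw [hmap, map_measureReal_apply (by fun_prop) hmeas]
  refine (measureReal_mono ?_).trans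
    ((measure_dotProduct_self_ge (n := n) zero_le_one le_rfl).trans (le_of_eq ?_))
  · intro x hx
    have h1 : 2 * n * σ ^ 2 < σ ^ 2 * (x ⬝ᵥ x) := by
      have h2 : (fun i => σ * x i) ⬝ᵥ (fun i => σ * x i) = σ ^ 2 * (x ⬝ᵥ x) := by
        simp only [dotProduct, Finset.mul_sum]
        exact Finset.sum_congr rfl fun i _ => by ring
      rw [← h2]; exact hx
    show (n:ℝ) * (1 + 1) ≤ x ⬝ᵥ x
    by_contra hcon
    nlinarith [sq_nonneg σ]
  · congr 1; ring

end Tails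

/-! ### One-dimensional marginals of the rows -/

section Marginals

variable {p : ℕ}

lemma map_dotProduct_multivariateGaussian {Sig : Matrix (Fin p) (Fin p) ℝ} (hS : Sig.PosSemidef)
    (u : Fin p → ℝ) :
    (multivariateGaussian 0 Sig).map (fun x => ∑ j, u j * x j) =
      gaussianReal 0 (u ⬝ᵥ (Sig *ᵥ u)).toNNReal := by
  have h1 : (fun x : EuclideanSpace ℝ (Fin p) => ∑ j, u j * x j) =
      innerSL ℝ (WithLp.toLp 2 u : EuclideanSpace ℝ (Fin p)) := by
    ext x
    simp [PiLp.inner_apply, mul_comm]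
  rw [h1, IsGaussian.map_eq_gaussianReal, ContinuousLinearMap.integral_comp_id_comm
    IsGaussian.integrable_id, integral_id_multivariateGaussian, map_zero]
  congr 2
  have h2 := covarianceBilin_multivariateGaussian (μ := 0) hS
    (WithLp.toLp 2 u : EuclideanSpace ℝ (Fin p)) (WithLp.toLp 2 u)
  rw [covarianceBilin_self IsGaussian.memLp_two_id] at h2
  exact h2

end Marginals

/-! ### Measurability of projections, and conditioning on one factor -/

section Measurability

lemma isClosed_exists_mem {X Y : Type*} [TopologicalSpace X] [TopologicalSpace Y] {K : Set Y}
    (hK : IsCompact K) {F : Set (X × Y)} (hF : IsClosed F) :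
    IsClosed {x | ∃ y ∈ K, (x, y) ∈ F} := by
  have : CompactSpace K := isCompact_iff_compactSpace.1 hK
  have h1 : IsClosed ((fun q : X × K => (q.1, (q.2 : Y))) ⁻¹' F) :=
    hF.preimage (by fun_prop)
  have h2 := isClosedMap_fst_of_compactSpace _ h1
  convert h2 using 1
  ext x
  simp only [Set.mem_ofPred_eq, Set.mem_image, Set.mem_preimage, Prod.exists, Subtype.exists]
  constructor
  · rintro ⟨y, hy, h⟩
    exact ⟨x, y, hy, h, rfl⟩
  · rintro ⟨x', y, hy, h, rfl⟩
    exact ⟨y, hy, h⟩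

/-- The projection of a closed set along a proper space is an `F_σ`, hence measurable. -/
lemma measurableSet_exists_of_isClosed {X Y : Type*} [TopologicalSpace X] [MeasurableSpace X]
    [OpensMeasurableSpace X] [SeminormedAddCommGroup Y] [ProperSpace Y] {F : Set (X × Y)}
    (hF : IsClosed F) : MeasurableSet {x | ∃ y, (x, y) ∈ F} := by
  have h : {x | ∃ y, (x, y) ∈ F} =
      ⋃ m : ℕ, {x | ∃ y ∈ Metric.closedBall (0 : Y) m, (x, y) ∈ F} := by
    ext x
    simp only [Set.mem_ofPred_eq, Set.mem_iUnion, mem_closedBall_zero_iff]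
    constructor
    · rintro ⟨y, hy⟩
      obtain ⟨m, hm⟩ := exists_nat_ge ‖y‖
      exact ⟨m, y, hm, hy⟩
    · rintro ⟨m, y, -, hy⟩
      exact ⟨y, hy⟩
  rw [h]
  exact MeasurableSet.iUnion fun m =>
    (isClosed_exists_mem (isCompact_closedBall _ _) hF).measurableSet

/-- Conditioning in the form used below: fix one independent factor and bound every slice uniformly.
Measurability of the whole event is needed, hence the closed projections above. -/
lemma prod_measureReal_le {X Y : Type*} [MeasurableSpace X] [MeasurableSpace Y]
    {μ : Measure X} {ν : Measure Y} [IsProbabilityMeasure μ] [IsProbabilityMeasure ν]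
    {B : Set (X × Y)} (hB : MeasurableSet B) {δ : ℝ} (hδ : 0 ≤ δ)
    (h : ∀ x, ν.real (Prod.mk x ⁻¹' B) ≤ δ) : (μ.prod ν).real B ≤ δ := by
  refine ENNReal.toReal_le_of_le_ofReal hδ ?_
  rw [Measure.prod_apply hB]
  calc ∫⁻ x, ν (Prod.mk x ⁻¹' B) ∂μ ≤ ∫⁻ _, ENNReal.ofReal δ ∂μ :=
        lintegral_mono fun x => (ENNReal.le_ofReal_iff_toReal_le (measure_ne_top _ _) hδ).2 (h x)
    _ = ENNReal.ofReal δ := by simp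

lemma prod_measureReal_le_symm {X Y : Type*} [MeasurableSpace X] [MeasurableSpace Y]
    {μ : Measure X} {ν : Measure Y} [IsProbabilityMeasure μ] [IsProbabilityMeasure ν]
    {B : Set (X × Y)} (hB : MeasurableSet B) {δ : ℝ} (hδ : 0 ≤ δ)
    (h : ∀ y, μ.real ((fun x => (x, y)) ⁻¹' B) ≤ δ) : (μ.prod ν).real B ≤ δ := by
  refine ENNReal.toReal_le_of_le_ofReal hδ ?_
  rw [Measure.prod_apply_symm hB]
  calc ∫⁻ y, μ ((fun x => (x, y)) ⁻¹' B) ∂ν ≤ ∫⁻ _, ENNReal.ofReal δ ∂ν :=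
        lintegral_mono fun x => (ENNReal.le_ofReal_iff_toReal_le (measure_ne_top _ _) hδ).2 (h x)
    _ = ENNReal.ofReal δ := by simp

end Measurability

/-! ### Concentration of the sample covariance -/

section Rows

variable {n p : ℕ}

/-- The law of a design with i.i.d. `N(0, Sig)` rows. -/
noncomputable abbrev rowLaw (n : ℕ) {p : ℕ} (Sig : Matrix (Fin p) (Fin p) ℝ) :
    Measure (Fin n → EuclideanSpace ℝ (Fin p)) :=
  Measure.pi fun _ => multivariateGaussian 0 Sig

lemma map_rowLaw {Sig : Matrix (Fin p) (Fin p) ℝ} (hS : Sig.PosSemidef) (u : Fin p → ℝ) :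
    (rowLaw n Sig).map (fun x i => ∑ j, u j * x i j) =
      Measure.pi fun _ => gaussianReal 0 (u ⬝ᵥ (Sig *ᵥ u)).toNNReal := by
  have := Measure.pi_map_pi (μ := fun _ : Fin n => multivariateGaussian 0 Sig)
    (f := fun _ x => ∑ j, u j * x j) (hμ := fun _ => by
      rw [map_dotProduct_multivariateGaussian hS]; infer_instance) (fun _ => by fun_prop)
  rw [this]
  simp only [map_dotProduct_multivariateGaussian hS]

lemma sum_extend_mul {S : Finset (Fin p)} (h : S → ℝ) (f : Fin p → ℝ) :
    ∑ j, extend S h j * f j = ∑ k : S, h k * f k := by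
  rw [sum_eq_sum_subtype (S := S) _ fun j hj => by simp [extend, hj]]
  simp only [extend_apply_mem]

lemma subDesign_mulVec_apply (x : Fin n → EuclideanSpace ℝ (Fin p)) {S : Finset (Fin p)}
    (h : S → ℝ) (i : Fin n) : (subDesign x S *ᵥ h) i = ∑ j, extend S h j * x i j := by
  rw [sum_extend_mul h fun j => x i j]
  simp [mulVec, dotProduct, subDesign, mul_comm]

lemma mulVec_extend_apply (Sig : Matrix (Fin p) (Fin p) ℝ) {S : Finset (Fin p)} (h : S → ℝ)
    (i : Fin p) : (Sig *ᵥ extend S h) i = ∑ k : S, h k * Sig i k := by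
  rw [← sum_extend_mul h fun j => Sig i j]
  simp [mulVec, dotProduct, mul_comm]

lemma extend_dotProduct_mulVec (Sig : Matrix (Fin p) (Fin p) ℝ) {S : Finset (Fin p)} (h : S → ℝ) :
    extend S h ⬝ᵥ (Sig *ᵥ extend S h) = h ⬝ᵥ (block Sig S S *ᵥ h) := by
  rw [dotProduct, sum_extend_mul h fun j => (Sig *ᵥ extend S h) j]
  simp only [mulVec_extend_apply]
  simp [dotProduct, mulVec, block, mul_comm]

/-- The sample covariance of the columns in `S` is within relative error `δ` of its mean. -/
def GramClose (Sig : Matrix (Fin p) (Fin p) ℝ) (S : Finset (Fin p)) (δ : ℝ)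
    (A : Matrix (Fin n) S ℝ) : Prop :=
  ∀ h : S → ℝ, |(A *ᵥ h) ⬝ᵥ (A *ᵥ h) - n * (h ⬝ᵥ (block Sig S S *ᵥ h))| ≤
    n * δ * (h ⬝ᵥ (block Sig S S *ᵥ h))

/-- For each unit vector `k` of the net, `A R k` has i.i.d. standard normal entries, so its squared
length is chi-square; a union bound over the net finishes. -/
theorem measure_not_gramClose_le {Sig : Matrix (Fin p) (Fin p) ℝ} (hS : Sig.PosSemidef)
    (hn : 1 ≤ n) {S : Finset (Fin p)} {R : Matrix S S ℝ} (hR : R.IsSymm)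
    (hRRQ : R * R * block Sig S S = 1) {t : ℝ} (ht0 : 0 ≤ t) (ht1 : t ≤ 1) :
    (rowLaw n Sig).real {x | ¬ GramClose Sig S (32 * t) (subDesign x S)} ≤
      5 ^ S.card * (2 * Real.exp (-(n * t ^ 2 / 8))) := by
  have hn' : (0:ℝ) < n := by exact_mod_cast hn
  obtain ⟨N, hNc, hN1, hN⟩ := exists_sphere_net S
  rw [Fintype.card_coe] at hNc
  have hsub : {x : Fin n → EuclideanSpace ℝ (Fin p) |
      ¬ GramClose Sig S (32 * t) (subDesign x S)} ⊆
      ⋃ k ∈ N, {x | n * t ≤ |(subDesign x S *ᵥ (R *ᵥ k)) ⬝ᵥ (subDesign x S *ᵥ (R *ᵥ k)) - n|} := by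
    intro x hx
    by_contra hcon
    refine hx fun h => ?_
    simp only [Set.mem_iUnion, Set.mem_ofPred_eq, not_exists, not_le] at hcon
    set A := subDesign x S
    -- The bound is taken at `R Q h`, which `R` maps back to `h`, and so becomes a statement about
    -- the unwhitened Gram form.
    have h1 := quadForm_le_of_net (isSymm_whitened hR A n) hN1 hN (t := t) (fun k hk => by
      rw [whitened_quadForm hR, hN1 k hk]
      have e : (n:ℝ)⁻¹ * ((A *ᵥ (R *ᵥ k)) ⬝ᵥ (A *ᵥ (R *ᵥ k))) - 1 =
        (n:ℝ)⁻¹ * ((A *ᵥ (R *ᵥ k)) ⬝ᵥ (A *ᵥ (R *ᵥ k)) - n) := by field_simp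
      rw [e, abs_mul, abs_of_pos (inv_pos.2 hn'), inv_mul_le_iff₀ hn']
      exact (hcon k hk).le) (R *ᵥ (block Sig S S *ᵥ h))
    have e2 : R *ᵥ (R *ᵥ (block Sig S S *ᵥ h)) = h := by
      rw [mulVec_mulVec, mulVec_mulVec, hRRQ, one_mulVec]
    rw [whitened_quadForm hR, ← whitened_dotProduct hR hRRQ, e2] at h1
    set q := h ⬝ᵥ (block Sig S S *ᵥ h)
    have e3 : (n:ℝ)⁻¹ * ((A *ᵥ h) ⬝ᵥ (A *ᵥ h)) - q =
      (n:ℝ)⁻¹ * ((A *ᵥ h) ⬝ᵥ (A *ᵥ h) - n * q) := by field_simp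
    rw [e3, abs_mul, abs_of_pos (inv_pos.2 hn'), inv_mul_le_iff₀ hn'] at h1
    linarith
  refine (measureReal_mono hsub (measure_ne_top _ _)).trans
    ((measureReal_biUnion_finset_le _ _).trans ?_)
  have hk : ∀ k ∈ N, (rowLaw n Sig).real
      {x | n * t ≤ |(subDesign x S *ᵥ (R *ᵥ k)) ⬝ᵥ (subDesign x S *ᵥ (R *ᵥ k)) - n|} ≤
      2 * Real.exp (-(n * t ^ 2 / 8)) := by
    intro k hk
    have hmap := map_rowLaw (n := n) hS (extend S (R *ᵥ k))
    rw [extend_dotProduct_mulVec, whitened_dotProduct hR hRRQ, hN1 k hk, Real.toNNReal_one] at hmap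
    have hmeas : MeasurableSet {g : Fin n → ℝ | n * t ≤ |g ⬝ᵥ g - n|} :=
      measurableSet_le measurable_const
        (((continuous_id.dotProduct continuous_id).sub continuous_const).abs).measurable
    have h2 := measure_abs_dotProduct_self_sub_ge (n := n) ht0 ht1
    rw [← hmap, map_measureReal_apply (by fun_prop) hmeas] at h2
    refine le_of_eq_of_le ?_ h2
    congr 1
    ext x
    have e : subDesign x S *ᵥ (R *ᵥ k) = fun i => ∑ j, extend S (R *ᵥ k) j * x i j :=
      funext fun i => subDesign_mulVec_apply x _ i
    simp only [Set.mem_ofPred_eq, Set.mem_preimage, e]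
  refine (Finset.sum_le_sum hk).trans ?_
  rw [Finset.sum_const, nsmul_eq_mul]
  exact mul_le_mul_of_nonneg_right (by exact_mod_cast hNc) (by positivity)

lemma isClosed_gram_lower (κ : Type*) [Fintype κ] (N : ℝ) :
    IsClosed {A : Fin n → κ → ℝ | ∀ h : κ → ℝ,
      N * (h ⬝ᵥ h) ≤ (Matrix.of A *ᵥ h) ⬝ᵥ (Matrix.of A *ᵥ h)} := by
  simp only [Set.ofPred_forall]
  refine isClosed_iInter fun h => isClosed_le continuous_const ?_
  have : Continuous fun A : Fin n → κ → ℝ => Matrix.of A *ᵥ h :=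
    Continuous.matrix_mulVec continuous_id continuous_const
  exact this.dotProduct this

end Rows

/-! ### Independence of the regression residual from the columns in `S` -/

section Independence

variable {n p : ℕ}

/-- The hypothesis says that the covariances vanish, and jointly Gaussian uncorrelated variables are
independent. The scalar is carried as a vector over `Unit` to fit the criterion for two Gaussian
vectors. -/
lemma indepFun_of_mulVec_eq_zero {Sig : Matrix (Fin p) (Fin p) ℝ} (hS : Sig.PosSemidef)
    {S : Finset (Fin p)} {w : Fin p → ℝ} (hw : ∀ k ∈ S, (Sig *ᵥ w) k = 0) :
    IndepFun (fun (x : EuclideanSpace ℝ (Fin p)) (k : S) => x k) (fun x => ∑ j, w j * x j)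
      (multivariateGaussian 0 Sig) := by
  let L : EuclideanSpace ℝ (Fin p) →L[ℝ] (S → ℝ) × (Unit → ℝ) :=
    (ContinuousLinearMap.pi fun k : S => EuclideanSpace.proj (k : Fin p)).prod
      (ContinuousLinearMap.pi fun _ => innerSL ℝ (WithLp.toLp 2 w : EuclideanSpace ℝ (Fin p)))
  have hL : (fun x : EuclideanSpace ℝ (Fin p) =>
      ((fun k : S => x k), fun _ : Unit => ∑ j, w j * x j)) = L := by
    ext x <;> simp [L, PiLp.inner_apply, mul_comm]
  have hg : HasGaussianLaw (fun x : EuclideanSpace ℝ (Fin p) =>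
      ((fun k : S => x k), fun _ : Unit => ∑ j, w j * x j)) (multivariateGaussian 0 Sig) := by
    rw [hL]
    exact ⟨inferInstance⟩
  have hi := hg.indepFun_of_covariance_eval (X := fun (k : S) (x : EuclideanSpace ℝ (Fin p)) => x k)
    (Y := fun (_ : Unit) (x : EuclideanSpace ℝ (Fin p)) => ∑ j, w j * x j) fun k _ => by
      have h1 := covarianceBilin_multivariateGaussian (μ := 0) hS
        (EuclideanSpace.single (k : Fin p) (1:ℝ)) (WithLp.toLp 2 w)
      rw [covarianceBilin_apply_eq_cov IsGaussian.memLp_two_id] at h1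
      have h2 : (EuclideanSpace.single (k : Fin p) (1:ℝ)).ofLp ⬝ᵥ (Sig *ᵥ w) = 0 := by
        simp [hw k k.2]
      rw [h2] at h1
      rw [← h1]
      congr 1
      · ext x; simp [PiLp.inner_apply]
      · ext x; simp [PiLp.inner_apply, mul_comm]
  exact hi.comp measurable_id (measurable_pi_apply ())

/-- The law of the columns in `S` and of an uncorrelated linear combination of the columns. -/
lemma map_rowLaw_prod {Sig : Matrix (Fin p) (Fin p) ℝ} (hS : Sig.PosSemidef)
    {S : Finset (Fin p)} {w : Fin p → ℝ} (hw : ∀ k ∈ S, (Sig *ᵥ w) k = 0) :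
    (rowLaw n Sig).map (fun x => ((fun i (k : S) => x i k), fun i => ∑ j, w j * x i j)) =
      (Measure.pi fun _ : Fin n => (multivariateGaussian 0 Sig).map fun x (k : S) => x k).prod
        (Measure.pi fun _ : Fin n => gaussianReal 0 (w ⬝ᵥ (Sig *ᵥ w)).toNNReal) := by
  have h1 := (indepFun_iff_map_prod_eq_prod_map_map (by fun_prop) (by fun_prop)).1
    (indepFun_of_mulVec_eq_zero hS hw)
  rw [map_dotProduct_multivariateGaussian hS] at h1
  have : IsProbabilityMeasure ((multivariateGaussian 0 Sig).map
      fun (x : EuclideanSpace ℝ (Fin p)) (k : S) => x k) :=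
    Measure.isProbabilityMeasure_map (by fun_prop)
  have h2 := Measure.pi_map_pi (μ := fun _ : Fin n => multivariateGaussian 0 Sig)
    (f := fun _ x => ((fun k : S => x k), ∑ j, w j * x j)) (hμ := fun _ => by
      rw [h1]; infer_instance) (fun _ => by fun_prop)
  have h3 := (measurePreserving_arrowProdEquivProdArrow (S → ℝ) ℝ (Fin n)
    (fun _ => (multivariateGaussian 0 Sig).map fun x (k : S) => x k)
    (fun _ => gaussianReal 0 (w ⬝ᵥ (Sig *ᵥ w)).toNNReal)).map_eq
  simp only [h1] at h2
  rw [← h3, ← h2, Measure.map_map (MeasurableEquiv.measurable _) (by fun_prop)]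
  rfl

end Independence

/-! ### The two Gaussian failure events -/

section Events

variable {n p : ℕ}

lemma continuous_of_mulVec {T κ : Type*} [TopologicalSpace T] [Fintype κ]
    {A : T → Fin n → κ → ℝ} {v : T → κ → ℝ} (hA : Continuous A) (hv : Continuous v) :
    Continuous fun t => Matrix.of (A t) *ᵥ v t :=
  Continuous.matrix_mulVec (A := fun t => Matrix.of (A t)) hA hv

lemma continuous_of_transpose_mulVec {T κ : Type*} [TopologicalSpace T] [Fintype κ]
    {A : T → Fin n → κ → ℝ} {v : T → Fin n → ℝ} (hA : Continuous A) (hv : Continuous v) :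
    Continuous fun t => (Matrix.of (A t))ᵀ *ᵥ v t :=
  Continuous.matrix_mulVec (A := fun t => (Matrix.of (A t))ᵀ)
    (Continuous.matrix_transpose (A := fun t => Matrix.of (A t)) hA) hv

variable {κ : Type*} [Fintype κ]

/-- `A` is well conditioned but coordinate `k` of the least squares noise term `(Aᵀ A)⁻¹ Aᵀ e`
is at least `a` in absolute value, for `q = (A, e)`. -/
def leastSquaresEvent (n : ℕ) [DecidableEq κ] (k : κ) (N a : ℝ) :
    Set ((Fin n → κ → ℝ) × (Fin n → ℝ)) :=
  {q | (∀ h : κ → ℝ, N * (h ⬝ᵥ h) ≤ (Matrix.of q.1 *ᵥ h) ⬝ᵥ (Matrix.of q.1 *ᵥ h)) ∧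
    ∃ w, (Matrix.of q.1)ᵀ *ᵥ (Matrix.of q.1 *ᵥ w) = Pi.single k 1 ∧
      a ≤ |(Matrix.of q.1 *ᵥ w) ⬝ᵥ q.2|}

lemma measurableSet_leastSquaresEvent [DecidableEq κ] (k : κ) (N a : ℝ) :
    MeasurableSet (leastSquaresEvent n k N a) := by
  have h1 : Continuous fun z : ((Fin n → κ → ℝ) × (Fin n → ℝ)) × (κ → ℝ) =>
      Matrix.of z.1.1 *ᵥ z.2 := continuous_of_mulVec (by fun_prop) (by fun_prop)
  have h2 : IsClosed {z : ((Fin n → κ → ℝ) × (Fin n → ℝ)) × (κ → ℝ) |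
      (Matrix.of z.1.1)ᵀ *ᵥ (Matrix.of z.1.1 *ᵥ z.2) = Pi.single k 1} :=
    isClosed_eq (continuous_of_transpose_mulVec (by fun_prop) h1) continuous_const
  have h3 : IsClosed {z : ((Fin n → κ → ℝ) × (Fin n → ℝ)) × (κ → ℝ) |
      a ≤ |(Matrix.of z.1.1 *ᵥ z.2) ⬝ᵥ z.1.2|} :=
    isClosed_le continuous_const (h1.dotProduct (by fun_prop)).abs
  exact ((isClosed_gram_lower κ N).preimage continuous_fst).measurableSet.inter
    (measurableSet_exists_of_isClosed (h2.inter h3))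

/-- With `A` fixed, `w` is column `k` of `(AᵀA)⁻¹` and `(A w) · e` is a Gaussian linear form in `e`.
Its coefficients have squared length `w k ≤ 1 / N`. -/
theorem measure_leastSquaresEvent_le [DecidableEq κ]
    (μ : Measure (Fin n → κ → ℝ)) [IsProbabilityMeasure μ] {v : ℝ≥0} (k : κ) {N a l : ℝ}
    (hN : 0 < N) (ha : 0 < a) (hl : 0 ≤ l) (h : 2 * v / N * l ≤ a ^ 2) :
    (μ.prod (Measure.pi fun _ : Fin n => gaussianReal 0 v)).real (leastSquaresEvent n k N a) ≤
      2 * Real.exp (-l) := by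
  refine prod_measureReal_le (measurableSet_leastSquaresEvent k N a) (by positivity) fun A => ?_
  set B := Matrix.of A with hB
  -- An empty slice has measure zero; any point of a nonempty one supplies the conditioning of `A`
  -- and the vector `w`, neither of which depends on `e`.
  rcases (Prod.mk A ⁻¹' leastSquaresEvent n k N a).eq_empty_or_nonempty with h0 | ⟨e₀, hA, w, hw, -⟩
  · rw [h0, measureReal_empty]
    positivity
  replace hA : ∀ h : κ → ℝ, N * (h ⬝ᵥ h) ≤ (B *ᵥ h) ⬝ᵥ (B *ᵥ h) := hA
  replace hw : Bᵀ *ᵥ (B *ᵥ w) = Pi.single k 1 := hw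
  have hBw : (B *ᵥ w) ⬝ᵥ (B *ᵥ w) = w k := by
    rw [← transpose_mulVec_dotProduct, hw]; simp
  have hle : (B *ᵥ w) ⬝ᵥ (B *ᵥ w) ≤ 1 / N := by
    have h1 := hA w
    have h2 : w k * w k ≤ w ⬝ᵥ w :=
      Finset.single_le_sum (f := fun i => w i * w i) (fun _ _ => mul_self_nonneg _)
        (Finset.mem_univ k)
    rw [hBw] at h1 ⊢
    rw [le_div_iff₀ hN]
    by_contra hcon
    have h3 : 0 < w k := by
      by_contra h0
      nlinarith
    nlinarith [mul_le_mul_of_nonneg_left h2 hN.le]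
  refine (measureReal_mono ?_).trans
    (measure_le_abs_dotProduct (v := v) (B *ᵥ w) ha hl (le_trans ?_ h))
  · rintro e ⟨-, w', hw', hle'⟩
    have : w' = w := by
      have h1 : Bᵀ *ᵥ (B *ᵥ (w' - w)) = 0 := by
        rw [mulVec_sub, mulVec_sub, hw, sub_eq_zero]; exact hw'
      have h2 := hA (w' - w)
      rw [← transpose_mulVec_dotProduct, h1, zero_dotProduct] at h2
      exact sub_eq_zero.1 (dotProduct_self_eq_zero.1 (le_antisymm
        (nonpos_of_mul_nonpos_right h2 hN) (dotProduct_self_nonneg' _)))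
    rw [this] at hle'
    exact hle'
  · have : 2 * (v:ℝ) / N * l = 2 * v * (1 / N) * l := by ring
    rw [this]
    gcongr

/-- `A` is well conditioned and the noise `e` is bounded, but the residual of the restricted Lasso
has inner product at least `a` with `g`, for `q = ((A, g), e)`. -/
def residualEvent (n : ℕ) (β : κ → ℝ) (m N V a : ℝ) :
    Set (((Fin n → κ → ℝ) × (Fin n → ℝ)) × (Fin n → ℝ)) :=
  {q | ((∀ h : κ → ℝ, N * (h ⬝ᵥ h) ≤ (Matrix.of q.1.1 *ᵥ h) ⬝ᵥ (Matrix.of q.1.1 *ᵥ h)) ∧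
    q.2 ⬝ᵥ q.2 ≤ V) ∧
    ∃ b, IsStationary (Matrix.of q.1.1) (Matrix.of q.1.1 *ᵥ β + q.2) m b ∧
      a ≤ |(Matrix.of q.1.1 *ᵥ β + q.2 - Matrix.of q.1.1 *ᵥ b) ⬝ᵥ q.1.2|}

lemma measurableSet_residualEvent (β : κ → ℝ) (m N V a : ℝ) :
    MeasurableSet (residualEvent n β m N V a) := by
  have hr : Continuous fun z : (((Fin n → κ → ℝ) × (Fin n → ℝ)) × (Fin n → ℝ)) × (κ → ℝ) =>
      Matrix.of z.1.1.1 *ᵥ β + z.1.2 - Matrix.of z.1.1.1 *ᵥ z.2 :=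
    ((continuous_of_mulVec (by fun_prop) (by fun_prop)).add (by fun_prop)).sub
      (continuous_of_mulVec (by fun_prop) (by fun_prop))
  have hg := continuous_of_transpose_mulVec (A := fun z :
    (((Fin n → κ → ℝ) × (Fin n → ℝ)) × (Fin n → ℝ)) × (κ → ℝ) => z.1.1.1) (by fun_prop) hr
  have h1 : IsClosed {z : (((Fin n → κ → ℝ) × (Fin n → ℝ)) × (Fin n → ℝ)) × (κ → ℝ) |
      IsStationary (Matrix.of z.1.1.1) (Matrix.of z.1.1.1 *ᵥ β + z.1.2) m z.2} := by
    simp only [IsStationary, Set.ofPred_and, Set.ofPred_forall]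
    refine (isClosed_iInter fun k => ?_).inter (isClosed_iInter fun k => ?_)
    · exact isClosed_le ((continuous_apply k).comp hg).abs continuous_const
    · exact isClosed_eq (((continuous_apply k).comp hg).mul (by fun_prop)) (by fun_prop)
  have h2 : IsClosed {z : (((Fin n → κ → ℝ) × (Fin n → ℝ)) × (Fin n → ℝ)) × (κ → ℝ) |
      a ≤ |(Matrix.of z.1.1.1 *ᵥ β + z.1.2 - Matrix.of z.1.1.1 *ᵥ z.2) ⬝ᵥ z.1.1.2|} :=
    isClosed_le continuous_const (hr.dotProduct (by fun_prop)).abs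
  have h3 : IsClosed {q : ((Fin n → κ → ℝ) × (Fin n → ℝ)) × (Fin n → ℝ) | q.2 ⬝ᵥ q.2 ≤ V} :=
    isClosed_le (continuous_snd.dotProduct continuous_snd) continuous_const
  have h4 : IsClosed {q : ((Fin n → κ → ℝ) × (Fin n → ℝ)) × (Fin n → ℝ) |
      ∀ h : κ → ℝ, N * (h ⬝ᵥ h) ≤ (Matrix.of q.1.1 *ᵥ h) ⬝ᵥ (Matrix.of q.1.1 *ᵥ h)} :=
    (isClosed_gram_lower κ N).preimage (continuous_fst.comp continuous_fst)
  exact (h4.inter h3).measurableSet.inter (measurableSet_exists_of_isClosed (h1.inter h2))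

/-- With `A` and `e` fixed, uniqueness of the stationary point makes the residual a constant vector,
so only the independent Gaussian `g` is random. -/
lemma measure_residualEvent_le [DecidableEq κ]
    (μ : Measure (Fin n → κ → ℝ)) [IsProbabilityMeasure μ] {v : ℝ≥0} (β : κ → ℝ) (e : Fin n → ℝ)
    {m N V a l : ℝ} (hN : 0 < N) (ha : 0 < a) (hl : 0 ≤ l)
    (h : 2 * v * (V + m ^ 2 * Fintype.card κ / N) * l ≤ a ^ 2) :
    (μ.prod (Measure.pi fun _ : Fin n => gaussianReal 0 v)).real
      ((fun q => (q, e)) ⁻¹' residualEvent n β m N V a) ≤ 2 * Real.exp (-l) := by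
  refine prod_measureReal_le ((measurableSet_residualEvent β m N V a).preimage (by fun_prop))
    (by positivity) fun A => ?_
  set B := Matrix.of A with hB
  rcases (Prod.mk A ⁻¹' ((fun q => (q, e)) ⁻¹' residualEvent n β m N V a)).eq_empty_or_nonempty with
    h0 | ⟨g₀, ⟨hA, hV⟩, b, hb, -⟩
  · rw [h0, measureReal_empty]
    positivity
  replace hA : ∀ h : κ → ℝ, N * (h ⬝ᵥ h) ≤ (B *ᵥ h) ⬝ᵥ (B *ᵥ h) := hA
  replace hV : e ⬝ᵥ e ≤ V := hV
  replace hb : IsStationary B (B *ᵥ β + e) m b := hb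
  have hinj : ∀ h, B *ᵥ h = 0 → h = 0 := fun h hh => by
    have := hA h
    rw [hh, zero_dotProduct] at this
    exact dotProduct_self_eq_zero.1 (le_antisymm
      (nonpos_of_mul_nonpos_right this hN) (dotProduct_self_nonneg' h))
  refine (measureReal_mono ?_).trans
    (measure_le_abs_dotProduct (v := v) (B *ᵥ β + e - B *ᵥ b) ha hl (le_trans ?_ h))
  · rintro g ⟨-, b', hb', hle'⟩
    rw [IsStationary.eq hinj hb' hb] at hle'
    exact hle'
  · have := hb.residual_le hN hA
    gcongr
    linarith

/-- The residual of the Lasso restricted to `S` is nearly orthogonal to a linear combination of the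
columns of the design that is uncorrelated with the columns in `S`. -/
theorem measure_residual_le {Sig : Matrix (Fin p) (Fin p) ℝ} (hS : Sig.PosSemidef)
    {S : Finset (Fin p)} {w : Fin p → ℝ} (hw : ∀ k ∈ S, (Sig *ᵥ w) k = 0)
    (τ : Measure (Fin n → ℝ)) [IsProbabilityMeasure τ] (β : S → ℝ)
    {m N V a l : ℝ} (hN : 0 < N) (ha : 0 < a) (hl : 0 ≤ l)
    (h : 2 * (w ⬝ᵥ (Sig *ᵥ w)) * (V + m ^ 2 * S.card / N) * l ≤ a ^ 2) :
    ((rowLaw n Sig).prod τ).real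
      {q | (((fun i (k : S) => q.1 i k), fun i => ∑ j, w j * q.1 i j), q.2) ∈
        residualEvent n β m N V a} ≤ 2 * Real.exp (-l) := by
  have hms := measurableSet_residualEvent (n := n) β m N V a
  have hmeas : Measurable fun x : Fin n → EuclideanSpace ℝ (Fin p) =>
      ((fun i (k : S) => x i k), fun i => ∑ j, w j * x i j) := by fun_prop
  refine prod_measureReal_le_symm (hms.preimage (by fun_prop)) (by positivity) fun e => ?_
  have hw0 : 0 ≤ w ⬝ᵥ (Sig *ᵥ w) := by simpa using hS.dotProduct_mulVec_nonneg w
  have : IsProbabilityMeasure ((multivariateGaussian 0 Sig).map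
      fun (x : EuclideanSpace ℝ (Fin p)) (k : S) => x k) :=
    Measure.isProbabilityMeasure_map (by fun_prop)
  have h1 := measure_residualEvent_le (n := n)
    (Measure.pi fun _ : Fin n => (multivariateGaussian 0 Sig).map fun x (k : S) => x k)
    (v := (w ⬝ᵥ (Sig *ᵥ w)).toNNReal) β e (m := m) (V := V) hN ha hl
    (by rwa [Real.coe_toNNReal _ hw0, Fintype.card_coe])
  rw [← map_rowLaw_prod hS hw, map_measureReal_apply hmeas (hms.preimage (by fun_prop))] at h1
  exact h1

end Events

/-! ### Population regression, and the Lasso on the good event -/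

section Deterministic

variable {n p : ℕ}

lemma block_posDef {Sig : Matrix (Fin p) (Fin p) ℝ} (hS : Sig.PosDef) (S : Finset (Fin p)) :
    (block Sig S S).PosDef :=
  hS.submatrix Subtype.val_injective

open scoped MatrixOrder in
lemma invSqrt_spec {m : Type*} [Fintype m] [DecidableEq m] {Q : Matrix m m ℝ} (hQ : Q.PosDef) :
    (invSqrt Q).IsSymm ∧ invSqrt Q * invSqrt Q * Q = 1 := by
  constructor
  · have h : (invSqrt Q).PosSemidef := Matrix.nonneg_iff_posSemidef.1 (CFC.sqrt_nonneg Q⁻¹)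
    simpa [Matrix.IsHermitian, Matrix.IsSymm, conjTranspose_eq_transpose_of_trivial] using
      h.isHermitian
  · have h : invSqrt Q * invSqrt Q = Q⁻¹ :=
      CFC.sqrt_mul_sqrt_self Q⁻¹ (Matrix.nonneg_iff_posSemidef.2 hQ.inv.posSemidef)
    rw [h]
    exact nonsing_inv_mul Q ((Matrix.isUnit_iff_isUnit_det Q).1 hQ.isUnit)

open scoped MatrixOrder in
lemma mul_dotProduct_le_of_spectrum {m : Type*} [Fintype m] [DecidableEq m] {Q : Matrix m m ℝ}
    (hQ : Q.PosDef) {c : ℝ} (hc : ∀ μ ∈ spectrum ℝ Q, c ≤ μ) (h : m → ℝ) :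
    c * (h ⬝ᵥ h) ≤ h ⬝ᵥ (Q *ᵥ h) := by
  have h0 : algebraMap ℝ (Matrix m m ℝ) c ≤ Q :=
    (algebraMap_le_iff_le_spectrum (ha := hQ.isHermitian.isSelfAdjoint)).2 hc
  rw [Algebra.algebraMap_eq_smul_one] at h0
  have h1 : (Q - c • 1).PosSemidef := Matrix.le_iff.1 h0
  have h2 := h1.dotProduct_mulVec_nonneg h
  simp only [star_trivial, sub_mulVec, smul_mulVec, one_mulVec, dotProduct_sub, dotProduct_smul,
    smul_eq_mul] at h2
  linarith

/-- The coefficients of the population regression of column `j` on the columns in `S`. -/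
noncomputable def regCoeff (Sig : Matrix (Fin p) (Fin p) ℝ) (S : Finset (Fin p)) (j : Fin p) :
    S → ℝ :=
  fun k => ∑ l : S, Sig j l * (block Sig S S)⁻¹ l k

/-- The linear form giving the residual of the population regression of column `j` on `S`. -/
noncomputable def regResidual (Sig : Matrix (Fin p) (Fin p) ℝ) (S : Finset (Fin p)) (j : Fin p) :
    Fin p → ℝ :=
  Pi.single j 1 - extend S (regCoeff Sig S j)

lemma sum_abs_regCoeff_le (Sig : Matrix (Fin p) (Fin p) ℝ) {S : Finset (Fin p)} {j : Fin p}
    (hj : j ∉ S) :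
    ∑ k, |regCoeff Sig S j k| ≤ infNorm (block Sig Sᶜ S * (block Sig S S)⁻¹) :=
  sum_abs_le_infNorm (block Sig Sᶜ S * (block Sig S S)⁻¹) ⟨j, Finset.mem_compl.2 hj⟩

lemma mulVec_regResidual {Sig : Matrix (Fin p) (Fin p) ℝ} (hS : Sig.PosDef) (S : Finset (Fin p))
    (j : Fin p) : ∀ k ∈ S, (Sig *ᵥ regResidual Sig S j) k = 0 := by
  intro k hk
  have hsymm : ∀ a b, Sig a b = Sig b a := fun a b => by
    simpa using congrFun (congrFun hS.isHermitian b) a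
  have hQ := nonsing_inv_mul (block Sig S S)
    ((Matrix.isUnit_iff_isUnit_det _).1 (block_posDef hS S).isUnit)
  have h1 : regCoeff Sig S j ᵥ* block Sig S S = fun l : S => Sig j l := by
    have : regCoeff Sig S j = (fun l : S => Sig j l) ᵥ* (block Sig S S)⁻¹ := rfl
    rw [this, vecMul_vecMul, hQ, vecMul_one]
  have h2 := congrFun h1 ⟨k, hk⟩
  rw [regResidual, mulVec_sub, Pi.sub_apply, mulVec_extend_apply, sub_eq_zero]
  simp only [mulVec_single_one, col_apply]
  rw [hsymm k j, ← h2]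
  simp only [vecMul, dotProduct, block, submatrix_apply]
  exact Finset.sum_congr rfl fun l _ => by rw [hsymm k]

/-- Pythagoras in the inner product of `Sig`: regressing on other variables cannot increase the
variance. -/
lemma regResidual_variance_le {Sig : Matrix (Fin p) (Fin p) ℝ} (hS : Sig.PosDef)
    (S : Finset (Fin p)) (j : Fin p) :
    regResidual Sig S j ⬝ᵥ (Sig *ᵥ regResidual Sig S j) ≤ Sig j j := by
  have h0 := mulVec_regResidual hS S j
  have h1 := extend_dotProduct_mulVec Sig (regCoeff Sig S j)
  have hsymm : ∀ a b, Sig a b = Sig b a := fun a b => by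
    simpa using congrFun (congrFun hS.isHermitian b) a
  set w := regResidual Sig S j with hw
  set u := extend S (regCoeff Sig S j) with hu
  have h2 : u ⬝ᵥ (Sig *ᵥ w) = 0 := by
    rw [dotProduct, hu, sum_extend_mul _ fun j => (Sig *ᵥ w) j]
    exact Finset.sum_eq_zero fun k _ => by rw [h0 k k.2, mul_zero]
  have h3 : u ⬝ᵥ (Sig *ᵥ Pi.single j 1) = u ⬝ᵥ (Sig *ᵥ u) := by
    rw [hw, regResidual, mulVec_sub, dotProduct_sub, sub_eq_zero] at h2
    exact h2
  have h4 : (Pi.single j 1 : Fin p → ℝ) ⬝ᵥ (Sig *ᵥ u) = u ⬝ᵥ (Sig *ᵥ Pi.single j 1) := by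
    simp only [single_dotProduct, one_mul, mulVec_single_one]
    simp only [mulVec, dotProduct, col_apply]
    exact Finset.sum_congr rfl fun l _ => by rw [hsymm j l, mul_comm]
  have h5 : w ⬝ᵥ (Sig *ᵥ w) = Sig j j - u ⬝ᵥ (Sig *ᵥ u) := by
    have : w ⬝ᵥ (Sig *ᵥ w) = (Pi.single j 1 : Fin p → ℝ) ⬝ᵥ (Sig *ᵥ w) - u ⬝ᵥ (Sig *ᵥ w) := by
      rw [← sub_dotProduct]; rfl
    rw [this, h2, sub_zero, hw, regResidual, mulVec_sub, dotProduct_sub, ← hu, h4, h3]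
    simp
  have h6 : 0 ≤ u ⬝ᵥ (Sig *ᵥ u) := by simpa using hS.posSemidef.dotProduct_mulVec_nonneg u
  linarith

/-- On the intersection of the good events, the Lasso recovers the support within the claimed
sup norm error. -/
theorem lasso_of_good {Sig : Matrix (Fin p) (Fin p) ℝ} (hSig : Sig.PosDef) (hn : 1 ≤ n)
    {S : Finset (Fin p)} {β : Fin p → ℝ} (hβ : ∀ j, j ∉ S → β j = 0)
    {x : Fin n → EuclideanSpace ℝ (Fin p)} {e : Fin n → ℝ} {lam κ K₁ Cmin V a δ : ℝ}
    (hκ : infNorm (block Sig Sᶜ S * (block Sig S S)⁻¹) ≤ κ)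
    (hK : infNorm (invSqrt (block Sig S S)) ^ 2 ≤ K₁) (hCmin : 0 < Cmin)
    (hspec : ∀ μ ∈ spectrum ℝ (block Sig S S), Cmin ≤ μ) (hlam : 0 < lam)
    (hδ0 : 0 ≤ δ) (hδ1 : δ ≤ 1 / 2) (ha : 0 ≤ a) (hV : e ⬝ᵥ e ≤ V)
    (hgram : GramClose Sig S δ (subDesign x S))
    (hls : ∀ k : S, ((fun i (k : S) => x i k), e) ∉ leastSquaresEvent n k (n * Cmin / 2) a)
    (hres : ∀ j, j ∉ S → (((fun i (k : S) => x i k),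
      fun i => ∑ l, regResidual Sig S j l * x i l), e) ∉
        residualEvent n (fun k : S => β k) (n * lam) (n * Cmin / 2) V ((1 - κ) * (n * lam))) :
    (lassoSolutions (design x) (fun i => (design x).mulVec β i + e i) lam).Nonempty ∧
      ∀ b ∈ lassoSolutions (design x) (fun i => (design x).mulVec β i + e i) lam,
        supp b ⊆ S ∧ supNormOn S (b - β) ≤ (1 + 2 * δ * √S.card) * K₁ * lam + a := by
  have hn' : (0:ℝ) < n := by exact_mod_cast hn
  have hQ := block_posDef hSig S
  obtain ⟨hR, hRRQ⟩ := invSqrt_spec hQ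
  set A := subDesign x S with hAdef
  have hof : Matrix.of (fun i (k : S) => x i k) = A := rfl
  set N : ℝ := n * Cmin / 2 with hN
  have hN0 : 0 < N := by positivity
  -- Relative error `δ ≤ 1/2` leaves at least half of the population eigenvalue bound, hence `N = n
  -- Cmin / 2`.
  have hlow : ∀ h : S → ℝ, N * (h ⬝ᵥ h) ≤ (A *ᵥ h) ⬝ᵥ (A *ᵥ h) := fun h => by
    have h1 := (abs_le.1 (hgram h)).1
    have h2 := mul_dotProduct_le_of_spectrum hQ hspec h
    set q := h ⬝ᵥ (block Sig S S *ᵥ h)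
    have h3 : 0 ≤ q := le_trans (mul_nonneg hCmin.le (dotProduct_self_nonneg' h)) h2
    have h4 : n * δ * q ≤ n * (1 / 2) * q := by gcongr
    have h5 : n * (Cmin * (h ⬝ᵥ h)) ≤ n * q := by gcongr
    rw [hN]
    linarith
  have hinj : ∀ h, A *ᵥ h = 0 → h = 0 := fun h hh => by
    have := hlow h
    rw [hh, zero_dotProduct] at this
    exact dotProduct_self_eq_zero.1 (le_antisymm
      (nonpos_of_mul_nonpos_right this hN0) (dotProduct_self_nonneg' h))
  set βS : S → ℝ := fun k => β k with hβS
  have hy : (fun i => (design x).mulVec β i + e i) = A *ᵥ βS + e := by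
    rw [← design_mulVec_of_support x hβ]; rfl
  obtain ⟨b, hb⟩ := exists_isStationary A (A *ᵥ βS + e) (mul_pos hn' hlam)
  set r := A *ᵥ βS + e - A *ᵥ b with hr
  have hoff : ∀ j, j ∉ S → |∑ i, x i j * (A *ᵥ βS + e - A *ᵥ b) i| < n * lam := by
    intro j hj
    set g : Fin n → ℝ := fun i => ∑ l, regResidual Sig S j l * x i l with hg
    have h1 : |r ⬝ᵥ g| < (1 - κ) * (n * lam) := by
      by_contra hcon
      exact hres j hj ⟨⟨hlow, hV⟩, b, hb, not_lt.1 hcon⟩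
    have h2 : ∀ i, x i j = g i + (A *ᵥ regCoeff Sig S j) i := fun i => by
      rw [hAdef, subDesign_mulVec_apply, hg]
      simp only [regResidual, Pi.sub_apply, sub_mul, Finset.sum_sub_distrib]
      simp [Pi.single_apply]
    have h3 : ∑ i, x i j * r i = r ⬝ᵥ g + regCoeff Sig S j ⬝ᵥ (Aᵀ *ᵥ r) := by
      rw [dotProduct_comm (regCoeff Sig S j), transpose_mulVec_dotProduct, ← dotProduct_add]
      exact Finset.sum_congr rfl fun i _ => by rw [h2 i, Pi.add_apply, mul_comm]
    have h4 : |regCoeff Sig S j ⬝ᵥ (Aᵀ *ᵥ r)| ≤ κ * (n * lam) :=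
      (abs_dotProduct_le hb.1).trans (mul_le_mul_of_nonneg_right
        ((sum_abs_regCoeff_le Sig hj).trans hκ) (by positivity))
    rw [h3]
    calc _ ≤ |r ⬝ᵥ g| + |regCoeff Sig S j ⬝ᵥ (Aᵀ *ᵥ r)| := abs_add_le _ _
      _ < n * lam := by linarith
  have hsol := lassoSolutions_of_witness hn x (A *ᵥ βS + e) hinj hb hoff
  rw [hy, hsol]
  refine ⟨Set.singleton_nonempty _, fun b' hb' => ?_⟩
  rw [Set.mem_singleton_iff] at hb'
  subst hb'
  refine ⟨fun j hj => ?_, ?_⟩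
  · by_contra hjS
    simp [supp, extend, hjS] at hj
  have hK0 : 0 ≤ K₁ := (sq_nonneg _).trans hK
  refine (pi_norm_le_iff_of_nonneg (by positivity)).2 fun k => ?_
  rw [Pi.sub_apply, extend_apply_mem, Real.norm_eq_abs]
  -- Dividing the dual vector by `n λ` puts it in the unit cube, so `v` carries the shrinkage bias:
  -- `b - β` is the least squares noise minus `λ v`.
  obtain ⟨v, hv⟩ := gram_mulVec_surjective hinj ((n:ℝ) • ((n * lam)⁻¹ • (Aᵀ *ᵥ r)))
  have hvk := abs_le_of_gram_mulVec_eq hR hRRQ hn' hδ0 hδ1 hgram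
    (z := (n * lam)⁻¹ • (Aᵀ *ᵥ r)) (fun l => by
      rw [Pi.smul_apply, smul_eq_mul, abs_mul, abs_of_pos (by positivity),
        inv_mul_le_iff₀ (by positivity), mul_one]
      exact hb.1 l) hv k
  rw [Fintype.card_coe] at hvk
  obtain ⟨w, hw⟩ := gram_mulVec_surjective hinj (Pi.single k 1)
  rw [← mulVec_mulVec] at hw hv
  have hwk : |(A *ᵥ w) ⬝ᵥ e| ≤ a := by
    by_contra hcon
    exact hls k ⟨hlow, w, hw, (not_le.1 hcon).le⟩
  have hentry : ∀ c : S → ℝ, c k = (A *ᵥ w) ⬝ᵥ (A *ᵥ c) := fun c => by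
    rw [← transpose_mulVec_dotProduct, hw]; simp
  have hdecomp : b k - β k = (A *ᵥ w) ⬝ᵥ e - lam * v k := by
    have h1 := hentry (b - βS)
    have h2 : A *ᵥ (b - βS) = e - r := by rw [hr, mulVec_sub]; abel
    have h3 : lam * v k = (A *ᵥ w) ⬝ᵥ r := by
      rw [hentry v, dotProduct_comm, ← transpose_mulVec_dotProduct, hv, smul_smul,
        smul_dotProduct, transpose_mulVec_dotProduct, dotProduct_comm r, smul_eq_mul]
      field_simp
    rw [h3, ← dotProduct_sub, ← h2, ← h1]
    rfl
  rw [hdecomp]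
  calc |(A *ᵥ w) ⬝ᵥ e - lam * v k| ≤ |(A *ᵥ w) ⬝ᵥ e| + |lam * v k| := abs_sub _ _
    _ ≤ a + lam * ((1 + 2 * δ * √S.card) * K₁) := by
        rw [abs_mul, abs_of_pos hlam]
        gcongr
        exact hvk.trans (by gcongr)
    _ = _ := by ring

end Deterministic

/-! ### Union bound and choice of parameters -/

section Probability

variable {n p : ℕ}

/-- Valid for arbitrary sets, so failure events can be transported without proving them measurable.
-/
lemma measureReal_preimage_le_map {X Y : Type*} [MeasurableSpace X] [MeasurableSpace Y]
    {μ : Measure X} [IsFiniteMeasure μ] {f : X → Y} (hf : AEMeasurable f μ) (s : Set Y) :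
    μ.real (f ⁻¹' s) ≤ (μ.map f).real s :=
  ENNReal.toReal_mono (measure_ne_top _ _) (Measure.le_map_apply hf s)

lemma exp_two_mul_ge_five_pow (s : ℕ) : (5:ℝ) ^ s ≤ Real.exp (2 * s) := by
  have h : (5:ℝ) ≤ Real.exp 2 := by
    have h1 := Real.exp_one_gt_d9
    have h2 : Real.exp 2 = Real.exp 1 * Real.exp 1 := by rw [← Real.exp_add]; norm_num
    rw [h2]
    nlinarith
  calc (5:ℝ) ^ s ≤ Real.exp 2 ^ s := pow_le_pow_left₀ (by norm_num) h s
    _ = Real.exp (2 * s) := by rw [← Real.exp_nat_mul]; ring_nf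

/-- With probability `1 - 2 exp (-3 L / 2000)` the sample covariance of the relevant columns is close
to its mean, at the rate that enters the sup norm bound. -/
theorem exists_gramClose {Sig : Matrix (Fin p) (Fin p) ℝ} (hS : Sig.PosDef) (hn : 1 ≤ n)
    (S : Finset (Fin p)) {L : ℝ} (hL : 1 / 2 ≤ 1 / 2000 * L) (hSL : S.card * L ≤ n / 128) :
    ∃ δ : ℝ, 0 ≤ δ ∧ δ ≤ 1 / 2 ∧
      2 * δ * √S.card ≤ 300 * (max (S.card : ℝ) (√(S.card * L)) / √n) ∧
      (rowLaw n Sig).real {x | ¬ GramClose Sig S δ (subDesign x S)} ≤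
        2 * Real.exp (-(3 / 2000 * L)) := by
  have hn' : (0:ℝ) < n := by exact_mod_cast hn
  have hL0 : 0 < L := by linarith
  rcases S.eq_empty_or_nonempty with rfl | hne
  · refine ⟨0, le_rfl, by norm_num, by simp, ?_⟩
    have : {x : Fin n → EuclideanSpace ℝ (Fin p) |
        ¬ GramClose Sig ∅ 0 (subDesign x ∅)} = ∅ := by
      ext x
      simp only [Set.mem_ofPred_eq, Set.mem_empty_iff_false, iff_false, not_not]
      intro h
      simp [dotProduct, mulVec]
    rw [this, measureReal_empty]
    positivity
  obtain ⟨hR, hRRQ⟩ := invSqrt_spec (block_posDef hS S)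
  have hs1 : (1:ℝ) ≤ S.card := by exact_mod_cast hne.card_pos
  set s : ℝ := (S.card : ℝ) with hs
  -- The hypothesis `hL` says `L ≥ 1000`, so both `s` and `L` are absorbed into `s L ≤ n / 128`.
  -- This yields `t ≤ 1/64` and thus `δ = 32 t ≤ 1/2`.
  have hLs : L ≤ s * L := le_mul_of_one_le_left hL0.le hs1
  have hss : s ≤ 1 / 1000 * (s * L) := by nlinarith
  -- Chosen so that `n t² / 8 = 2 s + 3 L / 2000`: the term `2 s` pays for the `5 ^ s` points of the
  -- net, the other is the final exponent.
  set t : ℝ := √(8 * (2 * s + 3 / 2000 * L) / n) with ht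
  have ht2 : t ^ 2 = 8 * (2 * s + 3 / 2000 * L) / n := Real.sq_sqrt (by positivity)
  have ht0 : 0 ≤ t := Real.sqrt_nonneg _
  have ht64 : t ≤ 1 / 64 := by
    refine Real.sqrt_le_iff.2 ⟨by norm_num, ?_⟩
    rw [div_le_iff₀ hn']
    linarith
  refine ⟨32 * t, by positivity, by linarith, ?_, ?_⟩
  · set M := max s √(s * L) with hM
    have hM1 : s ≤ M := le_max_left _ _
    have hM2 : s * L ≤ M ^ 2 := (Real.sqrt_le_left (by positivity)).1 (le_max_right _ _)
    have hM0 : 0 ≤ M := by linarith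
    -- After squaring, the coefficient of `M² / n` on the left is at most `64² * 8 * (2 + 3/2000)`,
    -- about `65600`, below `300²`.
    refine le_of_sq_le_sq ?_ (by positivity)
    rw [mul_pow, mul_pow, mul_pow, mul_pow, div_pow, ht2, Real.sq_sqrt (by positivity),
      Real.sq_sqrt hn'.le, mul_div_assoc', mul_div_assoc', mul_div_assoc', div_mul_eq_mul_div]
    refine div_le_div_of_nonneg_right ?_ hn'.le
    nlinarith [mul_self_le_mul_self (by linarith : 0 ≤ s) hM1]
  · refine (measure_not_gramClose_le hS.posSemidef hn hR hRRQ ht0 (by linarith)).trans ?_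
    have h1 : (n:ℝ) * t ^ 2 / 8 = 2 * s + 3 / 2000 * L := by
      rw [ht2]; field_simp
    have h2 := exp_two_mul_ge_five_pow S.card
    rw [h1, neg_add, Real.exp_add]
    have h3 : Real.exp (2 * s) * Real.exp (-(2 * s)) = 1 := by
      rw [← Real.exp_add]; simp
    calc (5:ℝ) ^ S.card * (2 * (Real.exp (-(2 * s)) * Real.exp (-(3 / 2000 * L))))
        ≤ Real.exp (2 * s) * (2 * (Real.exp (-(2 * s)) * Real.exp (-(3 / 2000 * L)))) := by
          gcongr
      _ = 2 * Real.exp (-(3 / 2000 * L)) *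
          (Real.exp (2 * s) * Real.exp (-(2 * s))) := by ring
      _ = _ := by rw [h3, mul_one]

/-- The failure events that control the behaviour of the Lasso. -/
def badEvent (n : ℕ) (Sig : Matrix (Fin p) (Fin p) ℝ) (S : Finset (Fin p)) (β : S → ℝ)
    (m N V a a' δ : ℝ) : Set ((Fin n → EuclideanSpace ℝ (Fin p)) × (Fin n → ℝ)) :=
  (Prod.snd ⁻¹' {e | V < e ⬝ᵥ e} ∪ Prod.fst ⁻¹' {x | ¬ GramClose Sig S δ (subDesign x S)}) ∪
    ((⋃ k ∈ (Finset.univ : Finset S),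
      {q | ((fun i (k : S) => q.1 i k), q.2) ∈ leastSquaresEvent n k N a}) ∪
    ⋃ j ∈ Sᶜ, {q | (((fun i (k : S) => q.1 i k),
      fun i => ∑ l, regResidual Sig S j l * q.1 i l), q.2) ∈ residualEvent n β m N V a'})

/-- Each index contributes one Gaussian tail, through least squares if it lies in `S` and through
the residual otherwise; hence the factor `p`. Positivity of `a` is asked only for nonempty `S`,
since `a` vanishes in the application when `σ = 0`. -/
theorem measure_badEvent_le {Sig : Matrix (Fin p) (Fin p) ℝ} (hS : Sig.PosDef)
    {S : Finset (Fin p)} (β : S → ℝ) {σ m N a a' δ l ρ Cup : ℝ} (hN : 0 < N)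
    (ha : S.Nonempty → 0 < a) (ha' : 0 < a') (hl : 0 ≤ l) (hCup : ∀ j, Sig j j ≤ Cup)
    (h : 2 * σ ^ 2 / N * l ≤ a ^ 2)
    (h' : 2 * Cup * (2 * n * σ ^ 2 + m ^ 2 * S.card / N) * l ≤ a' ^ 2)
    (hρ : (rowLaw n Sig).real {x | ¬ GramClose Sig S δ (subDesign x S)} ≤ ρ) :
    ((rowLaw n Sig).prod (Measure.pi fun _ : Fin n => gaussianReal 0 (σ ^ 2).toNNReal)).real
      (badEvent n Sig S β m N (2 * n * σ ^ 2) a a' δ) ≤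
        Real.exp (-(1 / 8 * n)) + ρ + p * (2 * Real.exp (-l)) := by
  set τ : Measure (Fin n → ℝ) := Measure.pi fun _ : Fin n => gaussianReal 0 (σ ^ 2).toNNReal with hτ
  have h1 : ((rowLaw n Sig).prod τ).real (Prod.snd ⁻¹' {e | 2 * n * σ ^ 2 < e ⬝ᵥ e}) ≤
      Real.exp (-(1 / 8 * n)) := by
    refine (measureReal_preimage_le_map measurable_snd.aemeasurable _).trans ?_
    rw [Measure.map_snd_prod, measure_univ, one_smul]
    exact measure_noise_gt
  have h2 : ((rowLaw n Sig).prod τ).real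
      (Prod.fst ⁻¹' {x | ¬ GramClose Sig S δ (subDesign x S)}) ≤ ρ := by
    refine (measureReal_preimage_le_map measurable_fst.aemeasurable _).trans ?_
    rw [Measure.map_fst_prod, measure_univ, one_smul]
    exact hρ
  have h3 : ∀ k ∈ (Finset.univ : Finset S), ((rowLaw n Sig).prod τ).real
      {q | ((fun i (k : S) => q.1 i k), q.2) ∈ leastSquaresEvent n k N a} ≤
        2 * Real.exp (-l) := by
    intro k _
    have hf : Measurable fun (x : Fin n → EuclideanSpace ℝ (Fin p)) i (k : S) => x i k := by
      fun_prop
    have := Measure.isProbabilityMeasure_map (μ := rowLaw n Sig) hf.aemeasurable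
    have hk := measure_leastSquaresEvent_le
      ((rowLaw n Sig).map fun x i (k : S) => x i k) (v := (σ ^ 2).toNNReal) k hN (ha ⟨k, k.2⟩) hl
      (by rwa [Real.coe_toNNReal _ (sq_nonneg σ)])
    refine le_trans ?_ hk
    rw [← hτ]
    have hmap := Measure.map_prod_map (rowLaw n Sig) τ hf measurable_id
    rw [Measure.map_id] at hmap
    rw [hmap]
    exact measureReal_preimage_le_map (hf.prodMap measurable_id).aemeasurable _
  have h4 : ∀ j ∈ Sᶜ, ((rowLaw n Sig).prod τ).real
      {q | (((fun i (k : S) => q.1 i k),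
        fun i => ∑ l, regResidual Sig S j l * q.1 i l), q.2) ∈
          residualEvent n β m N (2 * n * σ ^ 2) a'} ≤ 2 * Real.exp (-l) := by
    intro j _
    refine measure_residual_le hS.posSemidef (mulVec_regResidual hS S j) τ β hN ha' hl
      (le_trans ?_ h')
    have := (regResidual_variance_le hS S j).trans (hCup j)
    gcongr
  refine (measureReal_union_le _ _).trans (le_trans (add_le_add
    ((measureReal_union_le _ _).trans (add_le_add h1 h2))
    ((measureReal_union_le _ _).trans (add_le_add
      ((measureReal_biUnion_finset_le _ _).trans (Finset.sum_le_sum h3))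
      ((measureReal_biUnion_finset_le _ _).trans (Finset.sum_le_sum h4)))))
    (le_of_eq ?_))
  have hcard : (S.card : ℝ) + (Sᶜ.card : ℝ) = p := by
    have := Finset.card_add_card_compl S
    rw [Fintype.card_fin] at this
    exact_mod_cast this
  simp only [Finset.sum_const, nsmul_eq_mul, Finset.card_univ, Fintype.card_coe]
  rw [← hcard]
  ring

lemma noise_pos {S : Finset (Fin p)} {σ lam Cmin : ℝ} (hσ : 0 ≤ σ) (hlam : 0 < lam)
    (hslam : S.card * lam ^ 2 ≤ σ ^ 2 * Cmin / 2) (hne : S.Nonempty) : 0 < σ := by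
  refine lt_of_le_of_ne hσ fun h0 => ?_
  rw [← h0] at hslam
  have : (0:ℝ) < S.card := by exact_mod_cast hne.card_pos
  have : 0 < S.card * lam ^ 2 := by positivity
  simp at hslam
  linarith

/-- Multiply the lower bound on `λ²` by `s` and insert the upper bound on `s λ²`. A diagonal entry
of the block gives `Cmin ≤ Cup`, after which `σ² Cup` cancels. This is the implicit sample size
condition. -/
lemma card_mul_le {Sig : Matrix (Fin p) (Fin p) ℝ} (hSig : Sig.PosDef) {S : Finset (Fin p)}
    {σ lam κ Cmin Cup L : ℝ} (hσ : 0 ≤ σ) (hκ0 : 0 ≤ κ) (hκ1 : κ < 1) (hCup0 : 0 < Cup)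
    (hspec : ∀ μ ∈ spectrum ℝ (block Sig S S), Cmin ≤ μ) (hCup : ∀ j, Sig j j ≤ Cup)
    (hlam : 0 < lam) (hslam : S.card * lam ^ 2 ≤ σ ^ 2 * Cmin / 2)
    (hlam3 : 64 * σ ^ 2 * Cup * L ≤ n * ((1 - κ) ^ 2 * lam ^ 2)) :
    S.card * L ≤ n / 128 := by
  rcases S.eq_empty_or_nonempty with h0 | hne
  · rw [h0]; simp; positivity
  have hσ0 := noise_pos hσ hlam hslam hne
  obtain ⟨k, hk⟩ := hne
  have hCC : Cmin ≤ Cup := by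
    have h1 := mul_dotProduct_le_of_spectrum (block_posDef hSig S) hspec (Pi.single ⟨k, hk⟩ 1)
    simp [block] at h1
    exact h1.trans (hCup k)
  have h1 : (1 - κ) ^ 2 ≤ 1 := by nlinarith
  have h2 : S.card * (64 * σ ^ 2 * Cup * L) ≤ n * (σ ^ 2 * Cup / 2) := by
    calc S.card * (64 * σ ^ 2 * Cup * L) ≤ S.card * (n * ((1 - κ) ^ 2 * lam ^ 2)) := by gcongr
      _ = n * ((1 - κ) ^ 2 * (S.card * lam ^ 2)) := by ring
      _ ≤ n * (1 * (σ ^ 2 * Cmin / 2)) := by gcongr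
      _ ≤ n * (σ ^ 2 * Cup / 2) := by rw [one_mul]; gcongr
  have h3 : (σ ^ 2 * Cup) * (S.card * L) ≤ (σ ^ 2 * Cup) * (n / 128) := by linarith
  exact le_of_mul_le_mul_left h3 (by positivity)

/-- The support is recovered within the claimed sup norm error, except on an event whose probability
is controlled by the failure events. -/
theorem measure_compl_recovery_le {Ω : Type*} [MeasurableSpace Ω] {P : Measure Ω}
    [IsProbabilityMeasure P] (hn : 1 ≤ n) (hp : 1 ≤ p)
    {Sig : Matrix (Fin p) (Fin p) ℝ} {β : Fin p → ℝ} {σ lam κ K₁ Cmin Cup L : ℝ}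
    {X : Fin n → Ω → EuclideanSpace ℝ (Fin p)} {ε : Fin n → Ω → ℝ} {S : Finset (Fin p)}
    (hS : S = supp β) (hSig : Sig.PosDef)
    (hX : ∀ i, HasLaw (X i) (multivariateGaussian 0 Sig) P) (hXi : iIndepFun X P) (hσ : 0 ≤ σ)
    (hε : ∀ i, HasLaw (ε i) (gaussianReal 0 (σ ^ 2).toNNReal) P) (hεi : iIndepFun ε P)
    (hind : IndepFun (fun ω i => X i ω) (fun ω i => ε i ω) P)
    (hκ : infNorm (block Sig Sᶜ S * (block Sig S S)⁻¹) ≤ κ) (hκ1 : κ < 1)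
    (hK : infNorm (invSqrt (block Sig S S)) ^ 2 ≤ K₁) (hCmin : 0 < Cmin)
    (hspec : ∀ μ ∈ spectrum ℝ (block Sig S S), Cmin ≤ μ) (hCup : ∀ j, Sig j j ≤ Cup)
    (hlam : 0 < lam) (hslam : S.card * lam ^ 2 ≤ σ ^ 2 * Cmin / 2)
    (hlam2 : 8 * σ / (1 - κ) * √(Cup * L / n) ≤ lam) (hcL : 1 / 2 ≤ 1 / 2000 * L) :
    P.real {ω |
      (lassoSolutions (design fun i => X i ω)
        (fun i => (design fun i => X i ω).mulVec β i + ε i ω) lam).Nonempty ∧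
      ∀ b ∈ lassoSolutions (design fun i => X i ω)
        (fun i => (design fun i => X i ω).mulVec β i + ε i ω) lam,
        supp b ⊆ S ∧
        supNormOn S (b - β) ≤
          (1 + 300 * (max (S.card : ℝ) (√(S.card * L)) / √n)) * K₁ * lam +
            4 * σ * √(L / (Cmin * n))}ᶜ ≤
      Real.exp (-(1 / 8 * n)) + 2 * Real.exp (-(3 / 2000 * L)) + p * (2 * Real.exp (-(4 * L))) := by
  have hn' : (0:ℝ) < n := by exact_mod_cast hn
  have hL0 : 0 < L := by linarith
  have hκ0 : 0 ≤ κ := (infNorm_nonneg _).trans hκ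
  have h1κ : 0 < 1 - κ := by linarith
  have hCup0 : 0 < Cup := hSig.diag_pos.trans_le (hCup ⟨0, hp⟩)
  have hlam3 : 64 * σ ^ 2 * Cup * L ≤ n * ((1 - κ) ^ 2 * lam ^ 2) := by
    have h1 : 0 ≤ 8 * σ / (1 - κ) * √(Cup * L / n) := by positivity
    have h2 := pow_le_pow_left₀ h1 hlam2 2
    rw [mul_pow, div_pow, Real.sq_sqrt (by positivity), div_mul_eq_mul_div,
      div_le_iff₀ (by positivity), mul_div_assoc', div_le_iff₀ hn'] at h2
    linarith
  have hσpos : S.Nonempty → 0 < σ := noise_pos hσ hlam hslam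
  have hSL : S.card * L ≤ n / 128 :=
    card_mul_le hSig hσ hκ0 hκ1 hCup0 hspec hCup hlam hslam hlam3
  obtain ⟨δ, hδ0, hδ1, hδC, hδP⟩ := exists_gramClose hSig hn S hcL hSL
  set a := 4 * σ * √(L / (Cmin * n)) with ha
  have ha0 : 0 ≤ a := by positivity
  have hbad := measure_badEvent_le (n := n) hSig (fun k : S => β k) (σ := σ) (m := n * lam)
    (N := n * Cmin / 2) (a := a) (a' := (1 - κ) * (n * lam)) (l := 4 * L) (Cup := Cup)
    (by positivity) (fun hne => by have := hσpos hne; positivity) (by positivity) (by positivity)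
    hCup (by
      -- The exponent `l = 4 L` makes `2 σ² l / N = 16 σ² L / (n Cmin)`, exactly `a²`; this is the
      -- `4` in the error bound.
      rw [ha, mul_pow, Real.sq_sqrt (by positivity)]
      refine le_of_eq ?_
      field_simp
      ring) (by
      -- The bound on `s λ²` is used here: the fitted dual vector adds at most `n σ²` to the noise
      -- level `2 n σ²`. The requirement is then `24 ≤ 64`, where `64` is the square of the `8` in
      -- the lower bound on `λ`.
      have h1 : (n * lam) ^ 2 * S.card / (n * Cmin / 2) ≤ n * σ ^ 2 := by
        rw [div_le_iff₀ (by positivity)]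
        have := mul_le_mul_of_nonneg_left hslam (sq_nonneg (n:ℝ))
        linarith
      calc 2 * Cup * (2 * n * σ ^ 2 + (n * lam) ^ 2 * S.card / (n * Cmin / 2)) * (4 * L)
          ≤ 2 * Cup * (2 * n * σ ^ 2 + n * σ ^ 2) * (4 * L) := by gcongr
        _ = n * (24 * (σ ^ 2 * Cup * L)) := by ring
        _ ≤ n * (64 * σ ^ 2 * Cup * L) := by
          have : 0 ≤ σ ^ 2 * Cup * L := by positivity
          exact mul_le_mul_of_nonneg_left (by linarith) hn'.le
        _ ≤ n * (n * ((1 - κ) ^ 2 * lam ^ 2)) := by gcongr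
        _ = _ := by ring) hδP
  have hXm : AEMeasurable (fun ω i => X i ω) P := aemeasurable_pi_lambda _ fun i => (hX i).aemeasurable
  have hεm : AEMeasurable (fun ω i => ε i ω) P := aemeasurable_pi_lambda _ fun i => (hε i).aemeasurable
  have hlaw : P.map (fun ω => ((fun i => X i ω), fun i => ε i ω)) =
      (rowLaw n Sig).prod (Measure.pi fun _ : Fin n => gaussianReal 0 (σ ^ 2).toNNReal) := by
    rw [(indepFun_iff_map_prod_eq_prod_map_map hXm hεm).1 hind,
      (iIndepFun_iff_map_fun_eq_pi_map fun i => (hX i).aemeasurable).1 hXi,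
      (iIndepFun_iff_map_fun_eq_pi_map fun i => (hε i).aemeasurable).1 hεi]
    simp only [fun i => (hX i).map_eq, fun i => (hε i).map_eq]
  rw [← hlaw] at hbad
  refine (measureReal_mono fun ω hω => ?_).trans
    ((measureReal_preimage_le_map (hXm.prodMk hεm) _).trans hbad)
  by_contra hcon
  refine hω ?_
  simp only [badEvent, Set.mem_preimage, Set.mem_union, Set.mem_iUnion, Set.mem_ofPred_eq,
    not_or, not_exists, not_lt, not_not, Finset.mem_univ, Finset.mem_compl] at hcon
  obtain ⟨⟨hc1, hc2⟩, hc3, hc4⟩ := hcon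
  have hβ : ∀ j, j ∉ S → β j = 0 := fun j hj => by
    rw [hS] at hj
    simpa [supp] using hj
  have hgood := lasso_of_good hSig hn hβ hκ hK hCmin hspec hlam hδ0 hδ1 ha0 hc1 hc2
    (fun k => hc3 k trivial) hc4
  refine ⟨hgood.1, fun b hb => ⟨(hgood.2 b hb).1, (hgood.2 b hb).2.trans ?_⟩⟩
  have hK0 : 0 ≤ K₁ := (sq_nonneg _).trans hK
  gcongr

end Probability

end LassoGaussian

/-! ### Assembly of the absolute constants -/

theorem mainTheorem4 :
    ∃ (C₀ c₁ c₂ c₃ : ℝ) (C : ℕ → ℕ → ℕ → ℝ),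
      0 < C₀ ∧ 0 < c₁ ∧ 0 < c₂ ∧ 0 < c₃ ∧
      (∀ n p s : ℕ, 0 ≤ C n p s ∧
        C n p s ≤ C₀ * (max (s : ℝ) (Real.sqrt (s * Real.log p)) / Real.sqrt n)) ∧
      ∀ {Ω : Type*} [MeasurableSpace Ω] (P : Measure Ω) [IsProbabilityMeasure P]
        (n p : ℕ) (_ : 1 ≤ n) (_ : 1 ≤ p)
        (Sig : Matrix (Fin p) (Fin p) ℝ) (β : Fin p → ℝ)
        (σ lam κ K₁ Cmin Clow Cup : ℝ)
        (X : Fin n → Ω → EuclideanSpace ℝ (Fin p)) (ε : Fin n → Ω → ℝ)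
        (S : Finset (Fin p)) (_ : S = LassoGaussian.supp β)
        (s : ℕ) (_ : s = S.card),
        -- the rows of the design are i.i.d. `N(0, Sig)`
        Sig.PosDef →
        (∀ i, HasLaw (X i) (multivariateGaussian 0 Sig) P) →
        iIndepFun X P →
        -- the noise is i.i.d. `N(0, σ²)` and independent of the design
        0 ≤ σ →
        (∀ i, HasLaw (ε i) (gaussianReal 0 (σ ^ 2).toNNReal) P) →
        iIndepFun ε P →
        IndepFun (fun ω i => X i ω) (fun ω i => ε i ω) P →
        -- population incoherence
        LassoGaussian.infNorm
          (LassoGaussian.block Sig Sᶜ S * (LassoGaussian.block Sig S S)⁻¹) ≤ κ →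
        κ < 1 →
        LassoGaussian.infNorm
          (LassoGaussian.invSqrt (LassoGaussian.block Sig S S)) ^ 2 ≤ K₁ →
        -- eigenvalue and diagonal bounds
        0 < Cmin →
        (∀ μ ∈ spectrum ℝ (LassoGaussian.block Sig S S), Cmin ≤ μ) →
        0 < Clow →
        (∀ j, Clow ≤ 1 / Sig⁻¹ j j) →
        (∀ j, Sig j j ≤ Cup) →
        -- conditions on `(n, p, s, lam)`
        0 < lam →
        s * lam ^ 2 ≤ σ ^ 2 * Cmin / 2 →
        8 * σ / (1 - κ) * Real.sqrt (Cup * Real.log p / n) ≤ lam →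
        1 - c₁ / n - 2 * Real.exp (-c₂ * Real.log p) - 2 * Real.exp (-c₃ * n) <
          P.real {ω |
            (LassoGaussian.lassoSolutions (LassoGaussian.design fun i => X i ω)
              (fun i => (LassoGaussian.design fun i => X i ω).mulVec β i + ε i ω) lam).Nonempty ∧
            ∀ b ∈ LassoGaussian.lassoSolutions (LassoGaussian.design fun i => X i ω)
              (fun i => (LassoGaussian.design fun i => X i ω).mulVec β i + ε i ω) lam,
              LassoGaussian.supp b ⊆ S ∧
              LassoGaussian.supNormOn S (b - β) ≤
                (1 + C n p s) * K₁ * lam +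
                  4 * σ * Real.sqrt (Real.log p / (Cmin * n))} := by
  refine ⟨300, 1, 1 / 2000, 1 / 8,
    fun n p s => 300 * (max (s : ℝ) (Real.sqrt (s * Real.log p)) / Real.sqrt n),
    by norm_num, by norm_num, by norm_num, by norm_num, fun n p s => ⟨by positivity, le_rfl⟩, ?_⟩
  intro Ω _ P _ n p hn hp Sig β σ lam κ K₁ Cmin Clow Cup X ε S hS s hs hSig hX hXi hσ hε hεi hind
    hκ hκ1 hK hCmin hspec _ _ hCup hlam hslam hlam2
  subst hs
  have hn' : (0:ℝ) < n := by exact_mod_cast hn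
  have hfail := LassoGaussian.measure_compl_recovery_le hn hp hS hSig hX hXi hσ hε hεi hind hκ hκ1 hK hCmin
    hspec hCup hlam hslam hlam2
  set L := Real.log p with hLdef
  set G := {ω |
      (LassoGaussian.lassoSolutions (LassoGaussian.design fun i => X i ω)
        (fun i => (LassoGaussian.design fun i => X i ω).mulVec β i + ε i ω) lam).Nonempty ∧
      ∀ b ∈ LassoGaussian.lassoSolutions (LassoGaussian.design fun i => X i ω)
        (fun i => (LassoGaussian.design fun i => X i ω).mulVec β i + ε i ω) lam,
        LassoGaussian.supp b ⊆ S ∧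
        LassoGaussian.supNormOn S (b - β) ≤
          (1 + 300 * (max (S.card : ℝ) (√(S.card * L)) / √n)) * K₁ * lam +
            4 * σ * √(L / (Cmin * n))}
  have hn1 : 0 < 1 / (n:ℝ) := by positivity
  -- For such small `p` the claimed lower bound is negative. Otherwise `exp x ≥ 1 + x` forces `L >
  -- 1000`, as the concentration step requires.
  by_cases hp1 : 1 ≤ 2 * Real.exp (-(1 / 2000) * L)
  · have h1 : 0 ≤ P.real G := measureReal_nonneg
    have h2 := Real.exp_pos (-(1 / 8) * (n:ℝ))
    linarith
  rw [not_le] at hp1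
  have hcL : 1 / 2 ≤ 1 / 2000 * L := by
    have := Real.add_one_le_exp (-(1 / 2000) * L)
    linarith
  have hL0 : 0 < L := by linarith
  have hPbad := hfail hcL
  have hone : 1 ≤ P.real G + P.real Gᶜ := by
    have := measureReal_union_le (μ := P) G Gᶜ
    rwa [Set.union_compl_self, probReal_univ] at this
  have hp0 : (0:ℝ) < p := by exact_mod_cast hp
  have hpexp : p * Real.exp (-(4 * L)) = Real.exp (-(3 * L)) := by
    nth_rewrite 1 [← Real.exp_log hp0]
    rw [← hLdef, ← Real.exp_add]
    ring_nf
  have h3L : Real.exp (-(3 * L)) ≤ Real.exp (-(3 / 2000 * L)) :=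
    Real.exp_le_exp.2 (by linarith)
  have hcube : Real.exp (-(3 / 2000 * L)) = Real.exp (-(1 / 2000) * L) ^ 3 := by
    rw [← Real.exp_nat_mul]; push_cast; ring_nf
  set q := Real.exp (-(1 / 2000) * L)
  have hq0 : 0 < q := Real.exp_pos _
  -- Here `q < 1/2`. The tripled exponent `3 / 2000` makes the failure terms `2 q³ + 2 exp (-3 L) ≤
  -- 4 q³ ≤ q`, within the allowed `2 q`.
  have hq3 : q ^ 3 ≤ q / 4 := by nlinarith [mul_pos hq0 hq0]
  have he8 : Real.exp (-(1 / 8 * (n:ℝ))) = Real.exp (-(1 / 8) * (n:ℝ)) := by ring_nf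
  have he8p := Real.exp_pos (-(1 / 8) * (n:ℝ))
  rw [he8] at hPbad
  nlinarith
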